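/- Let $1\le\beta<2$, $0<\hat\alpha<\alpha$, and let $\lambda>0$ satisfy $\kappa\lambda<1$, where $$\kappa=\sup_{J>0}\frac{J^3\sinh(\pi/2)}{\sinh(\pi J/2)}=1.60036\ldots$$ (in particular every $0<\lambda<1/1.601$ is allowed). There are $\rho^*,r^*>0$ and $K>0$, depending only on $\lambda,\alpha,\hat\alpha,\beta$, such that the following holds for all $0<\rho\le\rho^*$, $0<r\le r^*$ with $\rho,r<1$, all $I_+^*>0$, and every function $$g(\varphi,t)=\sum_{k,l\ge 0}a_{k,l}\cos(k\varphi-lt-\sigma_{k,l}),\qquad \hat\alpha\rho^{\beta k}r^{\beta l}\le|a_{k,l}|\le\alpha\rho^kr^l,$$ normalized by $\sigma_{1,0}=\sigma_{0,1}=0$ and $a_{1,0},a_{0,1}>0$, with $|a_{1,0}/a_{0,1}|=\lambda$. Let $p_0(t)=2/\cosh t$, $q_0(t)=4\arctan e^{\pm t}$ be the separatrix of the pendulum $\pm(p^2/2+\cos q-1)$, let $h=\cos q\; g(\varphi,t)$, and let $$\mathcal L(I,\varphi,s)=-\int_{-\infty}^{\infty}\bigl(\cos q_0(x)-\cos 0\bigr)\,g(\varphi+Ix,s+x)\,dx$$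 be its Melnikov potential. Put $A_{k,l}(I)=\dfrac{2\pi(kI-l)}{\sinh(\pi(kI-l)/2)}a_{k,l}$ (equal to $4a_{k,l}$ if $kI=l$); $A_{0,0}$ and $A_{0,1}$ do not depend on $I$. The crest of $\mathcal L(I,\cdot,\cdot)$ is the set $I\,\partial_\varphi\mathcal L+\partial_s\mathcal L=0$, and $\mathcal C_M(I)$ is its connected component through the maximum of $\mathcal L(I,\cdot,\cdot)$ on the torus. Let $\tau^*(I,\varphi,s)$ be the $\tau$ of least absolute value with $(\varphi-I\tau,s-\tau)\in\mathcal C_M(I)$, and let $$\mathcal L^*(I,\tilde\theta)=\mathcal L\bigl(I,\tilde\theta-I\tau^*(I,\tilde\theta,0),-\tau^*(I,\tilde\theta,0)\bigr)$$ be the reduced Poincaré function. Then for every $I\in[-1/2,I_+^*]$: (1) $\mathcal C_M(I)$ is a curve $s=\xi_M(I,\varphi)$ (mod $2\pi$), where $\xi_M(I,\varphi)\in(-\pi,\pi]$ and $A_{0,1}\,\bigl|\xi_M(I,\varphi)+\arcsin(\alpha(I)\sin\varphi)\bigr|\le K(\rho+r)^2$ for all $\varphi$, with $\alpha(I)=IA_{1,0}(I)/A_{0,1}$.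 For $|s|\le\pi/2$ and every $\varphi$, $\tau^*(I,\varphi,s)$ exists and is unique, and $\mathcal L^*(I,\varphi-Is)=\mathcal L(I,\varphi-I\tau^*(I,\varphi,s),s-\tau^*(I,\varphi,s))$. (2) The function $\tilde\theta\mapsto\mathcal L^*(I,\tilde\theta)$ is $C^2$ and $2\pi$-periodic. There are $\theta_M<\theta_m<\theta_M+2\pi$ such that $\theta_M$ is a non-degenerate maximum ($\partial_{\tilde\theta}\mathcal L^*=0$, $\partial^2_{\tilde\theta}\mathcal L^*<0$), $\theta_m$ is a non-degenerate minimum ($\partial_{\tilde\theta}\mathcal L^*=0$, $\partial^2_{\tilde\theta}\mathcal L^*>0$), and $\mathcal L^*(I,\cdot)$ is strictly decreasing on $[\theta_M,\theta_m]$ and strictly increasing on $[\theta_m,\theta_M+2\pi]$, with $\partial_{\tilde\theta}\mathcal L^*\ne0$ in the interiors. The maximum is close to $0$ and the minimum is close to $\pi$: for every $\eta>0$ there are $\rho_\eta,r_\eta>0$, depending only on $\eta,I_+^*,\lambda,\alpha,\hat\alpha,\beta$, such that $\theta_M,\theta_m$ can be chosen with $|\theta_M|<\eta$ and $|\theta_m-\pi|<\eta$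 whenever $\rho\le\rho_\eta$ and $r\le r_\eta$. (3) For all $\tilde\theta$, with $\tau^*=\tau^*(I,\tilde\theta,0)$, $$\Bigl|\mathcal L^*(I,\tilde\theta)-\bigl(A_{0,0}\cos\sigma_{0,0}+A_{1,0}(I)\cos(\tilde\theta-I\tau^*)+A_{0,1}\cos\xi_M(I,\tilde\theta-I\tau^*)\bigr)\Bigr|\le K(\rho+r)^2 .$$ -/

import Mathlib

noncomputable section

namespace APrioriUnstable

/-- The Fourier series `g(φ,t) = ∑_{(k,l) ∈ ℕ²} a_{k,l} cos(kφ - lt - σ_{k,l})`. -/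
def g (a σ : ℕ → ℕ → ℝ) (φ t : ℝ) : ℝ :=
  ∑' kl : ℕ × ℕ, a kl.1 kl.2 * Real.cos (kl.1 * φ - kl.2 * t - σ kl.1 kl.2)

/-- The perturbation `h(p,q,I,φ,t) = f(q) g(φ,t)` with `f(q) = cos q`. -/
def h (a σ : ℕ → ℕ → ℝ) (_p q _I φ t : ℝ) : ℝ :=
  Real.cos q * g a σ φ t

/-- The `p`-component of the separatrix of the pendulum `±(p²/2 + cos q - 1)`. -/
def p₀ (t : ℝ) : ℝ := 2 / Real.cosh t

/-- The `q`-component of the separatrix; `e = 1` or `e = -1` is the sign of the pendulum. -/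
def q₀ (e t : ℝ) : ℝ := 4 * Real.arctan (Real.exp (e * t))

/-- The Melnikov potential `𝓛(I,φ,s)` of `h` along the separatrix. -/
def melnikov (a σ : ℕ → ℕ → ℝ) (e I φ s : ℝ) : ℝ :=
  -∫ x : ℝ, (h a σ (p₀ x) (q₀ e x) I (φ + I * x) (s + x) - h a σ 0 0 I (φ + I * x) (s + x))

/-- `A_{k,l}(I) = 2π (kI-l) / sinh(π(kI-l)/2) · a_{k,l}`; for `kI = l` the factor is understood
as its limit `4`. -/
def A (a : ℕ → ℕ → ℝ) (k l : ℕ) (I : ℝ) : ℝ :=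
  (if (k : ℝ) * I - l = 0 then 4
    else 2 * Real.pi * (k * I - l) / Real.sinh (Real.pi / 2 * (k * I - l))) * a k l

/-- `α(I) = I A_{1,0}(I) / A_{0,1}`. -/
def crestSlope (a : ℕ → ℕ → ℝ) (I : ℝ) : ℝ := I * A a 1 0 I / A a 0 1 I

/-- The crest: the points `(φ,s)` where `I ∂_φ 𝓛 + ∂_s 𝓛 = 0`, with both angles lifted to `ℝ`. -/
def crest (a σ : ℕ → ℕ → ℝ) (e I : ℝ) : Set (ℝ × ℝ) :=
  {x | I * deriv (fun φ => melnikov a σ e I φ x.2) x.1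
      + deriv (fun s => melnikov a σ e I x.1 s) x.2 = 0}

/-- The crest `C_M(I)` through the maximum of `𝓛(I,·,·)`, lifted to `ℝ²`: the union of the
connected components of the crest that contain a maximum point of `𝓛(I,·,·)` (these points
form a `2πℤ²`-periodic set). -/
def crestM (a σ : ℕ → ℕ → ℝ) (e I : ℝ) : Set (ℝ × ℝ) :=
  {x | ∃ m : ℝ × ℝ, (∀ y : ℝ × ℝ, melnikov a σ e I y.1 y.2 ≤ melnikov a σ e I m.1 m.2) ∧
      x ∈ connectedComponentIn (crest a σ e I) m}

/-- The function `ξ_M(I,φ)` whose graph is `C_M(I)`, with the value of the angle `s` taken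
in `(-π, π]`. -/
def xiM (a σ : ℕ → ℕ → ℝ) (e I φ : ℝ) : ℝ :=
  Classical.epsilon fun s => s ∈ Set.Ioc (-Real.pi) Real.pi ∧ (φ, s) ∈ crestM a σ e I

/-- `τ` has minimal absolute value among the parameters at which the straight line
`τ ↦ (φ - Iτ, s - τ)` meets `C_M(I)`. -/
def IsTauStar (a σ : ℕ → ℕ → ℝ) (e I φ s τ : ℝ) : Prop :=
  (φ - I * τ, s - τ) ∈ crestM a σ e I ∧
    ∀ τ' : ℝ, (φ - I * τ', s - τ') ∈ crestM a σ e I → |τ| ≤ |τ'|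

/-- The function `τ*(I,φ,s)`. -/
def tauStar (a σ : ℕ → ℕ → ℝ) (e I φ s : ℝ) : ℝ :=
  Classical.epsilon (IsTauStar a σ e I φ s)

/-- The reduced Poincaré function `𝓛*(I,θ) = 𝓛(I, θ - I τ*(I,θ,0), -τ*(I,θ,0))`. -/
def reducedPoincare (a σ : ℕ → ℕ → ℝ) (e I θ : ℝ) : ℝ :=
  melnikov a σ e I (θ - I * tauStar a σ e I θ 0) (0 - tauStar a σ e I θ 0)

/-- The constant `κ = sup_{J > 0} J³ sinh(π/2) / sinh(πJ/2) = 1.60036…`, the supremum of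
`I α(I) / (a_{1,0} / a_{0,1})`. -/
def kappa : ℝ :=
  sSup ((fun J : ℝ => J ^ 3 * Real.sinh (Real.pi / 2) / Real.sinh (Real.pi / 2 * J)) '' Set.Ioi 0)

open Real in
theorem cube_le_sinh (x : ℝ) (hx : 0 < x) : 0.3709 * x ^ 3 ≤ sinh x := by
  have h := sum_le_hasSum (Finset.range 8) (fun i _ => by positivity) (Real.hasSum_sinh x)
  refine le_trans ?_ h
  have ha0 : 0 ≤ x^2/8.906 := by positivity
  have ha : (-2:ℝ) ≤ x^2 / 8.906 - 1 := by linarith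
  have b2 := one_add_mul_le_pow ha 2
  have b3 := one_add_mul_le_pow ha 3
  have b4 := one_add_mul_le_pow ha 4
  have b5 := one_add_mul_le_pow ha 5
  have b6 := one_add_mul_le_pow ha 6
  have b7 := one_add_mul_le_pow ha 7
  obtain ⟨y, hy⟩ : ∃ y, y = x^2 := ⟨_, rfl⟩
  rw [← hy] at ha b2 b3 b4 b5 b6 b7
  have hy0 : 0 < y := by rw [hy]; positivity
  have key : 0 ≤ 1 + (1/6 - 0.3709) * y + y^2/120 + y^3/5040 + y^4/362880 + y^5/39916800
      + y^6/6227020800 + y^7/1307674368000 := by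
    ring_nf at b2 b3 b4 b5 b6 b7 ⊢
    linarith
  have := mul_nonneg hx.le key
  subst hy
  simp only [Finset.sum_range_succ, Finset.sum_range_zero, Nat.factorial]
  norm_num
  norm_num at this
  nlinarith

open Real in
theorem sinh_half_pi_le : sinh (π/2) ≤ 2.3014 := by
  have h1 : exp (π/2) ≤ 4.8105 := by
    have : π / 2 ≤ 1.5707965 := by have := pi_lt_d6; norm_num at this ⊢; linarith
    refine (exp_le_exp.2 this).trans ?_
    have h := Real.exp_bound' (x := 1.5707965/2) (by norm_num) (by norm_num) (n := 12) (by norm_num)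
    have e : exp (1.5707965:ℝ) = exp (1.5707965/2)^2 := by rw [← exp_nat_mul]; norm_num
    rw [e]
    have h3 : exp (1.5707965/2:ℝ) ≤ 2.193284 := by
      refine h.trans ?_
      simp only [Finset.sum_range_succ, Finset.sum_range_zero, Nat.factorial]
      norm_num
    calc _ ≤ (2.193284:ℝ)^2 := by gcongr
      _ ≤ _ := by norm_num
  rw [sinh_eq, exp_neg]
  have : (4.8105:ℝ)⁻¹ ≤ (exp (π/2))⁻¹ := by gcongr
  norm_num at this h1 ⊢
  linarith

open Real in
theorem kappa_fun_le (J : ℝ) (hJ : 0 < J) : J^3 * sinh (π/2) / sinh (π/2*J) ≤ 1.601 := by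
  have hp := pi_gt_d6
  have hx : 0 < π/2*J := by positivity
  have h1 := cube_le_sinh _ hx
  have h2 := sinh_half_pi_le
  rw [div_le_iff₀ (sinh_pos_iff.2 hx)]
  have : (1.5707:ℝ)^3 ≤ (π/2)^3 := by gcongr; norm_num at hp ⊢; linarith
  have h4 : (1.570796:ℝ)^3 ≤ (π/2)^3 := by gcongr; norm_num at hp ⊢; linarith
  have hJ3 : 0 < J^3 := by positivity
  have : (1.570796:ℝ)^3 * J^3 ≤ (π/2*J)^3 := by rw [mul_pow]; gcongr
  have : J^3 * sinh (π/2) ≤ J^3*2.3014 := by gcongr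
  norm_num at *
  linarith

theorem bddAbove_kappa : BddAbove
    ((fun J : ℝ => J ^ 3 * Real.sinh (Real.pi / 2) / Real.sinh (Real.pi / 2 * J)) '' Set.Ioi 0) := by
  refine ⟨1.601, ?_⟩
  rintro _ ⟨J, hJ, rfl⟩
  exact kappa_fun_le J hJ

/-- The supremum in `kappa` is a genuine one, and `lam < 1 / 1.601` implies `lam < 1 / kappa`. -/
theorem kappa_bounds : 1 ≤ kappa ∧ kappa ≤ 1.601 := by
  constructor
  · refine le_csSup bddAbove_kappa ⟨1, by simp, ?_⟩
    have : Real.sinh (Real.pi / 2) ≠ 0 := (Real.sinh_pos_iff.2 (by positivity)).ne'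
    simp [this]
  · refine csSup_le ⟨_, 1, by simp, rfl⟩ ?_
    rintro _ ⟨J, hJ, rfl⟩
    exact kappa_fun_le J hJ

end APrioriUnstable

end

/-! The Fourier transform of `2 / cosh² x = -(cos q₀ - 1)` turns the Melnikov potential into the
Fourier series with coefficients `A_{k,l}(I)`; the transform comes from a Beta integral after a
sigmoid substitution. Since `β < 2`, the harmonics of order at least two are `O((ρ + r)²)`, which
is negligible compared with the lower bounds `α' ρ^β` and `α' r^β` of the first ones, and `𝓛` is
close to a constant plus `A_{1,0} cos φ + A_{0,1} cos s`. The condition `κ λ < 1` bounds `|α(I)|`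
and `|I α(I)|` away from `1`: the first bound makes the crest near `s = 0` a graph `s = ξ(φ)`, and
the second gives `|I ξ'| < 1`, so that this graph is transversal to the lines `(φ - I τ, s - τ)`
and `ψ ↦ ψ - I ξ(ψ)` is a diffeomorphism. Because `I ∂_φ 𝓛 + ∂_s 𝓛 = 0` on the crest, the
derivative of the reduced Poincaré function at `θ = ψ - I ξ(ψ)` is `∂_φ 𝓛(ψ, ξ(ψ)) ≈ -A_{1,0} sin
ψ`, which yields exactly one maximum and one minimum per period. -/

noncomputable section

namespace APrioriUnstable

open Real MeasureTheory Filter Topology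

/-- The Fourier weight of the Melnikov integral at frequency `ω`: the factor `2πω / sinh(πω/2)` in
`A`, with its limit `4` at `ω = 0`. -/
def sechWeight (ω : ℝ) : ℝ :=
  if ω = 0 then 4 else 2 * π * ω / sinh (π / 2 * ω)

theorem A_eq_sechWeight_mul (a : ℕ → ℕ → ℝ) (k l : ℕ) (I : ℝ) :
    A a k l I = sechWeight (k * I - l) * a k l := rfl

theorem integrable_sigmoid_mul_one_sub_sigmoid :
    Integrable fun x : ℝ => sigmoid x * (1 - sigmoid x) := by
  have h := (integrableOn_image_iff_integrableOn_abs_deriv_smul MeasurableSet.univ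
    (fun x _ => (hasDerivAt_sigmoid x).hasDerivWithinAt) sigmoid_injective.injOn
    (fun _ => (1 : ℝ))).1 (by
      rw [Set.image_univ, range_sigmoid]; exact integrableOn_const (by simp) (by simp))
  rw [integrableOn_univ] at h
  refine h.congr (.of_forall fun x => ?_)
  have : 0 ≤ 1 - sigmoid x := sub_nonneg.2 (sigmoid_le_one x)
  simp only [abs_of_nonneg (mul_nonneg (sigmoid_nonneg x) this), smul_eq_mul, mul_one]

theorem log_sigmoid_sub_log_one_sub_sigmoid (x : ℝ) :
    log (sigmoid x) - log (1 - sigmoid x) = x := by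
  rw [← sigmoid_neg, ← sigmoid_mul_rexp_neg, log_mul (sigmoid_pos x).ne' (exp_pos _).ne', log_exp]
  ring

theorem sigmoid_cpow_mul_one_sub_sigmoid_cpow_neg (x : ℝ) (z : ℂ) :
    (sigmoid x : ℂ) ^ z * (1 - sigmoid x : ℂ) ^ (-z) = Complex.exp (z * x) := by
  have h0 : 0 < sigmoid x := sigmoid_pos x
  have h1 : 0 < 1 - sigmoid x := sub_pos.2 (sigmoid_lt_one x)
  have hx : (log (sigmoid x) : ℂ) - (log (1 - sigmoid x) : ℂ) = x := by
    exact_mod_cast log_sigmoid_sub_log_one_sub_sigmoid x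
  rw [show (1 - sigmoid x : ℂ) = ((1 - sigmoid x : ℝ) : ℂ) by push_cast; rfl,
    Complex.cpow_def_of_ne_zero (by exact_mod_cast h0.ne'),
    Complex.cpow_def_of_ne_zero (by exact_mod_cast h1.ne'), ← Complex.exp_add,
    ← Complex.ofReal_log h0.le, ← Complex.ofReal_log h1.le]
  congr 1
  linear_combination z * hx

theorem integral_sigmoid_mul_one_sub_sigmoid_mul_cexp (z : ℂ) :
    ∫ x : ℝ, ((sigmoid x * (1 - sigmoid x) : ℝ) : ℂ) * Complex.exp (z * x)
      = Complex.betaIntegral (1 + z) (1 - z) := by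
  rw [Complex.betaIntegral, intervalIntegral.integral_of_le zero_le_one,
    integral_Ioc_eq_integral_Ioo, ← range_sigmoid, ← Set.image_univ,
    integral_image_eq_integral_abs_deriv_smul MeasurableSet.univ
      (fun x _ => (hasDerivAt_sigmoid x).hasDerivWithinAt) sigmoid_injective.injOn,
    Measure.restrict_univ]
  refine integral_congr_ae (.of_forall fun x => ?_)
  have h : 0 ≤ sigmoid x * (1 - sigmoid x) :=
    mul_nonneg (sigmoid_nonneg x) (sub_nonneg.2 (sigmoid_le_one x))
  simp only
  rw [abs_of_nonneg h, Complex.real_smul, add_sub_cancel_left, sub_sub_cancel_left,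
    sigmoid_cpow_mul_one_sub_sigmoid_cpow_neg]

theorem betaIntegral_one_add_one_sub {z : ℂ} (hz : z ≠ 0) (h₁ : -1 < z.re) (h₂ : z.re < 1) :
    Complex.betaIntegral (1 + z) (1 - z) = π * z / Complex.sin (π * z) := by
  have h := Complex.Gamma_mul_Gamma_eq_betaIntegral (s := 1 + z) (t := 1 - z)
    (by simpa [neg_lt_iff_pos_add'] using h₁) (by simpa using h₂)
  rw [show (1 + z) + (1 - z) = (1 : ℂ) + 1 by ring, Complex.Gamma_add_one _ one_ne_zero,
    Complex.Gamma_one, one_mul, one_mul] at h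
  rw [← h, add_comm (1 : ℂ), Complex.Gamma_add_one _ hz, mul_assoc,
    Complex.Gamma_mul_Gamma_one_sub]
  ring

theorem betaIntegral_eq_sechWeight (ω : ℝ) :
    Complex.betaIntegral (1 + ω / 2 * Complex.I) (1 - ω / 2 * Complex.I)
      = ((sechWeight ω / 4 : ℝ) : ℂ) := by
  rcases eq_or_ne ω 0 with rfl | hω
  · simp [sechWeight, Complex.betaIntegral]
  · rw [betaIntegral_one_add_one_sub (by simp [hω]) (by simp) (by simp),
      show (π : ℂ) * (ω / 2 * Complex.I) = (π / 2 * ω) * Complex.I by ring, Complex.sin_mul_I,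
      mul_div_mul_right _ _ Complex.I_ne_zero, sechWeight, if_neg hω]
    push_cast
    ring

theorem integral_sigmoid_mul_one_sub_sigmoid_mul_cos (ω c : ℝ) :
    ∫ x : ℝ, sigmoid x * (1 - sigmoid x) * cos (ω / 2 * x + c) = sechWeight ω / 4 * cos c := by
  set F : ℝ → ℂ := fun x => Complex.exp (c * Complex.I) *
    (((sigmoid x * (1 - sigmoid x) : ℝ) : ℂ) * Complex.exp (ω / 2 * Complex.I * x)) with hF
  have hFint : Integrable F := by
    refine ((integrable_sigmoid_mul_one_sub_sigmoid.ofReal (𝕜 := ℂ)).mul_bdd (c := 1)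
      (by fun_prop) (.of_forall fun x => ?_)).const_mul _
    rw [show (ω / 2 * Complex.I * x : ℂ) = ((ω / 2 * x : ℝ) : ℂ) * Complex.I by push_cast; ring,
      Complex.norm_exp_ofReal_mul_I]
  have hre : ∀ x, RCLike.re (F x) = sigmoid x * (1 - sigmoid x) * cos (ω / 2 * x + c) := by
    intro x
    simp only [hF, RCLike.re_eq_complex_re]
    rw [mul_left_comm, ← Complex.exp_add, Complex.re_ofReal_mul,
      show (c * Complex.I + ω / 2 * Complex.I * x : ℂ) = ((ω / 2 * x + c : ℝ) : ℂ) * Complex.I by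
        push_cast; ring, Complex.exp_ofReal_mul_I_re]
  simp_rw [← hre]
  rw [integral_re hFint, hF, integral_const_mul, integral_sigmoid_mul_one_sub_sigmoid_mul_cexp,
    betaIntegral_eq_sechWeight, mul_comm, RCLike.re_eq_complex_re, Complex.re_ofReal_mul,
    Complex.exp_ofReal_mul_I_re]

theorem two_div_cosh_sq_eq_sigmoid (t : ℝ) :
    2 / cosh t ^ 2 = 8 * (sigmoid (2 * t) * (1 - sigmoid (2 * t))) := by
  rw [← sigmoid_neg, sigmoid_def, sigmoid_def, cosh_eq, neg_neg, two_mul, neg_add, exp_add, exp_add,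
    exp_neg]
  field_simp
  ring

theorem integrable_two_div_cosh_sq : Integrable fun t : ℝ => 2 / cosh t ^ 2 := by
  simp_rw [two_div_cosh_sq_eq_sigmoid]
  exact (integrable_sigmoid_mul_one_sub_sigmoid.comp_mul_left' two_ne_zero).const_mul 8

theorem integral_two_div_cosh_sq_mul_cos (ω c : ℝ) :
    ∫ t : ℝ, 2 / cosh t ^ 2 * cos (ω * t + c) = sechWeight ω * cos c := by
  have h := Measure.integral_comp_mul_left
    (fun x : ℝ => sigmoid x * (1 - sigmoid x) * cos (ω / 2 * x + c)) 2
  rw [integral_sigmoid_mul_one_sub_sigmoid_mul_cos, smul_eq_mul, abs_of_pos (by norm_num)] at h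
  calc ∫ t : ℝ, 2 / cosh t ^ 2 * cos (ω * t + c)
      = ∫ t : ℝ, 8 * (sigmoid (2 * t) * (1 - sigmoid (2 * t)) * cos (ω / 2 * (2 * t) + c)) := by
        refine integral_congr_ae (.of_forall fun t => ?_)
        simp only
        rw [two_div_cosh_sq_eq_sigmoid, show ω / 2 * (2 * t) = ω * t by ring]
        ring
    _ = sechWeight ω * cos c := by rw [integral_const_mul, h]; ring

theorem cos_four_mul_arctan_exp_sub_one (t : ℝ) :
    cos (4 * arctan (exp t)) - 1 = -(2 / cosh t ^ 2) := by
  rw [show 4 * arctan (exp t) = 2 * (2 * arctan (exp t)) by ring, cos_two_mul, cos_two_mul,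
    cos_sq_arctan, cosh_eq, exp_neg]
  field_simp
  ring

theorem cos_q₀_sub_one {e : ℝ} (he : e = 1 ∨ e = -1) (t : ℝ) :
    cos (q₀ e t) - 1 = -(2 / cosh t ^ 2) := by
  rcases he with rfl | rfl <;> simp [q₀, cos_four_mul_arctan_exp_sub_one]

/-- `f` is differentiable on the plane with partial derivatives `f₁` and `f₂`. -/
def HasPartials (f f₁ f₂ : ℝ × ℝ → ℝ) : Prop :=
  ∀ x, HasFDerivAt f
    (f₁ x • ContinuousLinearMap.fst ℝ ℝ ℝ + f₂ x • ContinuousLinearMap.snd ℝ ℝ ℝ) x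

namespace HasPartials

variable {f f₁ f₂ : ℝ × ℝ → ℝ}

theorem continuous (hf : HasPartials f f₁ f₂) : Continuous f :=
  continuous_iff_continuousAt.2 fun x => (hf x).continuousAt

theorem hasDerivAt_comp (hf : HasPartials f f₁ f₂) {u v : ℝ → ℝ} {u' v' t : ℝ}
    (hu : HasDerivAt u u' t) (hv : HasDerivAt v v' t) :
    HasDerivAt (fun t => f (u t, v t)) (f₁ (u t, v t) * u' + f₂ (u t, v t) * v') t := by
  refine ((hf (u t, v t)).comp_hasDerivAt t (hu.prodMk hv)).congr_deriv ?_
  simp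

theorem hasDerivAt_fst (hf : HasPartials f f₁ f₂) (φ s : ℝ) :
    HasDerivAt (fun φ => f (φ, s)) (f₁ (φ, s)) φ := by
  simpa using hf.hasDerivAt_comp (hasDerivAt_id φ) (hasDerivAt_const φ s)

theorem hasDerivAt_snd (hf : HasPartials f f₁ f₂) (φ s : ℝ) :
    HasDerivAt (fun s => f (φ, s)) (f₂ (φ, s)) s := by
  simpa using hf.hasDerivAt_comp (hasDerivAt_const s φ) (hasDerivAt_id s)

end HasPartials

/-- The double Fourier series `∑ c_{k,l} cos(kφ - ls - σ_{k,l})` at `x = (φ, s)`. Its formal partial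
derivatives are series of the same kind, with all phases shifted by `-π/2`. -/
def trigSeries (c σ : ℕ × ℕ → ℝ) (x : ℝ × ℝ) : ℝ :=
  ∑' n : ℕ × ℕ, c n * cos (n.1 * x.1 - n.2 * x.2 - σ n)

theorem norm_mul_cos_le (c y : ℝ) : ‖c * cos y‖ ≤ |c| := by
  rw [norm_mul, Real.norm_eq_abs, Real.norm_eq_abs]
  exact mul_le_of_le_one_right (abs_nonneg _) (abs_cos_le_one _)

section TrigSeries

variable {c σ : ℕ × ℕ → ℝ}

theorem summable_trigSeries (hc : Summable fun n => |c n|) (x : ℝ × ℝ) :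
    Summable fun n : ℕ × ℕ => c n * cos (n.1 * x.1 - n.2 * x.2 - σ n) :=
  Summable.of_norm_bounded hc fun _ => norm_mul_cos_le _ _

theorem continuous_trigSeries (hc : Summable fun n => |c n|) : Continuous (trigSeries c σ) :=
  continuous_tsum (fun n => by fun_prop) hc fun _ _ => norm_mul_cos_le _ _

theorem abs_trigSeries_le (hc : Summable fun n => |c n|) (x : ℝ × ℝ) :
    |trigSeries c σ x| ≤ ∑' n, |c n| :=
  tsum_of_norm_bounded hc.hasSum fun _ => norm_mul_cos_le _ _

theorem trigSeries_add_two_pi_fst (φ s : ℝ) :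
    trigSeries c σ (φ + 2 * π, s) = trigSeries c σ (φ, s) := by
  refine tsum_congr fun n => ?_
  rw [show (n.1 : ℝ) * (φ + 2 * π, s).1 - n.2 * (φ + 2 * π, s).2 - σ n
    = ((n.1 : ℝ) * (φ, s).1 - n.2 * (φ, s).2 - σ n) + n.1 * (2 * π) by dsimp only; ring,
    cos_add_nat_mul_two_pi]

theorem trigSeries_add_two_pi_snd (φ s : ℝ) :
    trigSeries c σ (φ, s + 2 * π) = trigSeries c σ (φ, s) := by
  refine tsum_congr fun n => ?_
  rw [show (n.1 : ℝ) * (φ, s + 2 * π).1 - n.2 * (φ, s + 2 * π).2 - σ n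
    = ((n.1 : ℝ) * (φ, s).1 - n.2 * (φ, s).2 - σ n) - n.2 * (2 * π) by dsimp only; ring,
    cos_sub_nat_mul_two_pi]

theorem const_mul_trigSeries_add {d : ℕ × ℕ → ℝ} (hc : Summable fun n => |c n|)
    (hd : Summable fun n => |d n|) (r : ℝ) (x : ℝ × ℝ) :
    r * trigSeries c σ x + trigSeries d σ x = trigSeries (fun n => r * c n + d n) σ x := by
  simp only [trigSeries]
  rw [← tsum_mul_left,
    ← ((summable_trigSeries hc x).mul_left r).tsum_add (summable_trigSeries hd x)]
  exact tsum_congr fun n => by ring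

theorem hasPartials_mul_cos (k l c σ : ℝ) :
    HasPartials (fun x => c * cos (k * x.1 - l * x.2 - σ))
      (fun x => k * c * cos (k * x.1 - l * x.2 - (σ - π / 2)))
      (fun x => -l * c * cos (k * x.1 - l * x.2 - (σ - π / 2))) := by
  intro x
  have h : HasFDerivAt (fun x : ℝ × ℝ => k * x.1 - l * x.2 - σ)
      (k • ContinuousLinearMap.fst ℝ ℝ ℝ - l • ContinuousLinearMap.snd ℝ ℝ ℝ) x :=
    ((hasFDerivAt_fst.const_mul k).sub (hasFDerivAt_snd.const_mul l)).sub_const _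
  have e : cos (k * x.1 - l * x.2 - (σ - π / 2)) = -sin (k * x.1 - l * x.2 - σ) := by
    rw [← cos_add_pi_div_two]
    ring_nf
  refine (h.cos.const_mul c).congr_fderiv ?_
  ext <;> simp [e] <;> ring

theorem hasPartials_trigSeries (hc : Summable fun n => |c n|)
    (hc₁ : Summable fun n : ℕ × ℕ => |n.1 * c n|) (hc₂ : Summable fun n : ℕ × ℕ => |-n.2 * c n|) :
    HasPartials (trigSeries c σ) (trigSeries (fun n => n.1 * c n) fun n => σ n - π / 2)
      (trigSeries (fun n => -n.2 * c n) fun n => σ n - π / 2) := by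
  intro x
  have hbound : ∀ (n : ℕ × ℕ) (y z : ℝ),
      ‖((n.1 * c n * cos y) • ContinuousLinearMap.fst ℝ ℝ ℝ
        + (-n.2 * c n * cos z) • ContinuousLinearMap.snd ℝ ℝ ℝ)‖
      ≤ |(n.1 : ℝ) * c n| + |-(n.2 : ℝ) * c n| := by
    intro n y z
    refine (norm_add_le _ _).trans (add_le_add ?_ ?_) <;> rw [norm_smul]
    · exact (mul_le_of_le_one_right (norm_nonneg _) (ContinuousLinearMap.norm_fst_le ..)).trans
        (norm_mul_cos_le _ _)
    · exact (mul_le_of_le_one_right (norm_nonneg _) (ContinuousLinearMap.norm_snd_le ..)).trans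
        (norm_mul_cos_le _ _)
  refine (hasFDerivAt_tsum (hc₁.add hc₂) (fun n => hasPartials_mul_cos n.1 n.2 (c n) (σ n))
    (fun n _ => hbound n _ _) (summable_trigSeries hc 0) x).congr_fderiv ?_
  exact (((summable_trigSeries hc₁ x).hasSum.smul_const _).add
    ((summable_trigSeries hc₂ x).hasSum.smul_const _)).tsum_eq

end TrigSeries

theorem summable_pow_mul_half_pow (m : ℕ) :
    Summable fun n : ℕ × ℕ => (1 + n.1 + n.2 : ℝ) ^ m * (1 / 2) ^ (n.1 + n.2) := by
  have h : Summable fun n : ℕ => (1 + n : ℝ) ^ m * (1 / 2) ^ n := by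
    have h0 := (summable_nat_add_iff 1).2
      (summable_pow_mul_geometric_of_norm_lt_one (R := ℝ) m (r := 1 / 2) (by norm_num))
    refine (h0.mul_left 2).congr fun n => ?_
    push_cast
    ring
  refine Summable.of_nonneg_of_le (fun n => by positivity) (fun n => ?_)
    (h.mul_of_nonneg h (fun n => by positivity) fun n => by positivity)
  rw [pow_add, mul_mul_mul_comm, ← mul_pow]
  gcongr
  nlinarith

/-- The constant in the bound of the harmonics of order at least two of a trigonometric series with
geometrically decaying coefficients. -/
def tailConst : ℝ := 4 * ∑' n : ℕ × ℕ, (1 + n.1 + n.2 : ℝ) ^ 2 * (1 / 2) ^ (n.1 + n.2)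

theorem tailConst_pos : 0 < tailConst := by
  have := (summable_pow_mul_half_pow 2).tsum_pos (fun n => by positivity) (0, 0) (by simp)
  unfold tailConst
  positivity

/-- The part of a family of coefficients with `k + l ≥ 2`. -/
def tail (c : ℕ × ℕ → ℝ) (n : ℕ × ℕ) : ℝ := if 2 ≤ n.1 + n.2 then c n else 0

theorem abs_tail_le (c : ℕ × ℕ → ℝ) (n : ℕ × ℕ) : |tail c n| ≤ |c n| := by
  unfold tail
  split_ifs <;> simp

theorem trigSeries_eq_add_tail {c σ : ℕ × ℕ → ℝ} (hc : Summable fun n => |c n|) (x : ℝ × ℝ) :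
    trigSeries c σ x = c (0, 0) * cos (σ (0, 0)) + c (1, 0) * cos (x.1 - σ (1, 0))
      + c (0, 1) * cos (x.2 + σ (0, 1)) + trigSeries (tail c) σ x := by
  have htail : Summable fun n => |tail c n| :=
    Summable.of_nonneg_of_le (fun _ => abs_nonneg _) (abs_tail_le c) hc
  rw [trigSeries, trigSeries, ← sub_eq_iff_eq_add,
    ← (summable_trigSeries hc x).tsum_sub (summable_trigSeries htail x),
    tsum_eq_sum (s := {(0, 0), (1, 0), (0, 1)})]
  · rw [Finset.sum_insert (by simp), Finset.sum_insert (by simp), Finset.sum_singleton]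
    have e : cos (-x.2 - σ (0, 1)) = cos (x.2 + σ (0, 1)) := by rw [← cos_neg]; ring_nf
    simp [tail, e]
    ring
  · rintro ⟨k, l⟩ hn
    have : 2 ≤ k + l := by
      simp only [Finset.mem_insert, Finset.mem_singleton, Prod.mk.injEq, not_or] at hn
      omega
    simp [tail, this]

/-- The coefficients `c_{k,l}` decay geometrically with ratio `y ≤ 1/2`, up to the factor
`(1 + k + l)^m` that `m` differentiations produce. -/
structure GeometricDecay (C : ℝ) (m : ℕ) (y : ℝ) (c : ℕ × ℕ → ℝ) : Prop where
  ratio_nonneg : 0 ≤ y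
  ratio_le : y ≤ 1 / 2
  abs_le : ∀ n : ℕ × ℕ, |c n| ≤ C * ((1 + n.1 + n.2 : ℝ) ^ m * y ^ (n.1 + n.2))

namespace GeometricDecay

variable {C y : ℝ} {m : ℕ} {c σ : ℕ × ℕ → ℝ}

theorem const_nonneg (hc : GeometricDecay C m y c) : 0 ≤ C := by
  simpa using (abs_nonneg _).trans (hc.abs_le (0, 0))

theorem summable (hc : GeometricDecay C m y c) : Summable fun n => |c n| := by
  have := hc.const_nonneg
  have := hc.ratio_nonneg
  have := hc.ratio_le
  refine Summable.of_nonneg_of_le (fun _ => abs_nonneg _) (fun n => (hc.abs_le n).trans ?_)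
    ((summable_pow_mul_half_pow m).mul_left C)
  gcongr

theorem mul (hc : GeometricDecay C m y c) {b : ℕ × ℕ → ℝ}
    (hb : ∀ n : ℕ × ℕ, |b n| ≤ 1 + n.1 + n.2) :
    GeometricDecay C (m + 1) y fun n => b n * c n where
  ratio_nonneg := hc.ratio_nonneg
  ratio_le := hc.ratio_le
  abs_le n := by
    rw [abs_mul]
    refine (mul_le_mul (hb n) (hc.abs_le n) (abs_nonneg _) (by positivity)).trans_eq ?_
    ring

theorem fst_mul (hc : GeometricDecay C m y c) :
    GeometricDecay C (m + 1) y fun n => n.1 * c n :=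
  hc.mul fun n => by
    rw [Nat.abs_cast]
    linarith [(Nat.cast_nonneg n.2 : (0 : ℝ) ≤ n.2)]

theorem neg_snd_mul (hc : GeometricDecay C m y c) :
    GeometricDecay C (m + 1) y fun n => -n.2 * c n :=
  hc.mul fun n => by
    rw [abs_neg, Nat.abs_cast]
    linarith [(Nat.cast_nonneg n.1 : (0 : ℝ) ≤ n.1)]

theorem hasPartials_trigSeries (hc : GeometricDecay C m y c) :
    HasPartials (trigSeries c σ) (trigSeries (fun n => n.1 * c n) fun n => σ n - π / 2)
      (trigSeries (fun n => -n.2 * c n) fun n => σ n - π / 2) :=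
  APrioriUnstable.hasPartials_trigSeries hc.summable hc.fst_mul.summable hc.neg_snd_mul.summable

theorem abs_tail_le (hc : GeometricDecay C m y c) (hm : m ≤ 2) (n : ℕ × ℕ) :
    |tail c n| ≤ 4 * C * y ^ 2 * ((1 + n.1 + n.2 : ℝ) ^ 2 * (1 / 2) ^ (n.1 + n.2)) := by
  have hC := hc.const_nonneg
  have hy := hc.ratio_nonneg
  have hy' := hc.ratio_le
  unfold tail
  split_ifs with h
  · obtain ⟨j, hj⟩ := Nat.exists_eq_add_of_le h
    have h1 : (1 : ℝ) ≤ 1 + n.1 + n.2 := by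
      rw [add_assoc]
      exact le_add_of_nonneg_right (by positivity)
    calc |c n| ≤ C * ((1 + n.1 + n.2 : ℝ) ^ m * y ^ (n.1 + n.2)) := hc.abs_le n
      _ ≤ C * ((1 + n.1 + n.2 : ℝ) ^ 2 * (y ^ 2 * (1 / 2) ^ j)) := by
          rw [hj, pow_add]
          gcongr
      _ = _ := by
          rw [hj, pow_add (1 / 2 : ℝ)]
          ring
  · rw [abs_zero]
    positivity

theorem abs_trigSeries_sub_le (hc : GeometricDecay C m y c) (hm : m ≤ 2) (x : ℝ × ℝ) :
    |trigSeries c σ x - (c (0, 0) * cos (σ (0, 0)) + c (1, 0) * cos (x.1 - σ (1, 0))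
      + c (0, 1) * cos (x.2 + σ (0, 1)))| ≤ C * tailConst * y ^ 2 := by
  have hbound := (summable_pow_mul_half_pow 2).mul_left (4 * C * y ^ 2)
  have htail : Summable fun n => |tail c n| :=
    Summable.of_nonneg_of_le (fun _ => abs_nonneg _) (hc.abs_tail_le hm) hbound
  rw [trigSeries_eq_add_tail hc.summable, add_sub_cancel_left]
  refine (abs_trigSeries_le htail x).trans
    ((htail.tsum_le_tsum (hc.abs_tail_le hm) hbound).trans_eq ?_)
  rw [tsum_mul_left, tailConst]
  ring

end GeometricDecay

theorem integrable_two_div_cosh_sq_mul_cos (ω c : ℝ) :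
    Integrable fun x : ℝ => 2 / cosh x ^ 2 * cos (ω * x + c) :=
  integrable_two_div_cosh_sq.mul_bdd (c := 1) (by fun_prop)
    (Eventually.of_forall fun x => abs_cos_le_one _)

theorem integral_norm_two_div_cosh_sq_mul_cos_le (b ω c : ℝ) :
    ∫ x : ℝ, ‖b * (2 / cosh x ^ 2 * cos (ω * x + c))‖ ≤ |b| * ∫ x : ℝ, 2 / cosh x ^ 2 := by
  rw [← integral_const_mul]
  refine integral_mono ((integrable_two_div_cosh_sq_mul_cos ω c).const_mul b).norm
    (integrable_two_div_cosh_sq.const_mul _) fun x => ?_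
  have hx : (0 : ℝ) ≤ 2 / cosh x ^ 2 := by positivity
  dsimp only
  rw [norm_mul, Real.norm_eq_abs]
  gcongr
  exact (norm_mul_cos_le _ _).trans (abs_of_nonneg hx).le

theorem melnikov_eq_trigSeries {a σ : ℕ → ℕ → ℝ} {e : ℝ} (he : e = 1 ∨ e = -1)
    (ha : Summable fun n : ℕ × ℕ => |a n.1 n.2|) (I φ s : ℝ) :
    melnikov a σ e I φ s
      = trigSeries (fun n => A a n.1 n.2 I) (fun n => σ n.1 n.2) (φ, s) := by
  let F : ℕ × ℕ → ℝ → ℝ := fun n x =>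
    a n.1 n.2 * (2 / cosh x ^ 2 * cos ((n.1 * I - n.2) * x + (n.1 * φ - n.2 * s - σ n.1 n.2)))
  have hF : ∀ n, Integrable (F n) := fun n =>
    (integrable_two_div_cosh_sq_mul_cos _ _).const_mul _
  have hsummable : Summable fun n => ∫ x, ‖F n x‖ :=
    Summable.of_nonneg_of_le (fun n => by positivity)
      (fun n => integral_norm_two_div_cosh_sq_mul_cos_le _ _ _) (ha.mul_right _)
  have hseries : ∀ x, -(h a σ (p₀ x) (q₀ e x) I (φ + I * x) (s + x)
      - h a σ 0 0 I (φ + I * x) (s + x)) = ∑' n, F n x := by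
    intro x
    rw [h, h, cos_zero, ← sub_mul, cos_q₀_sub_one he, ← neg_mul, neg_neg, g, ← tsum_mul_left]
    refine tsum_congr fun n => ?_
    simp only [F]
    rw [mul_left_comm]
    ring_nf
  rw [melnikov, trigSeries, ← integral_neg]
  simp_rw [hseries]
  rw [← (hasSum_integral_of_summable_integral_norm hF hsummable).tsum_eq]
  refine tsum_congr fun n => ?_
  simp only [F]
  rw [integral_const_mul, integral_two_div_cosh_sq_mul_cos, A_eq_sechWeight_mul]
  ring

theorem sechWeight_of_ne_zero {ω : ℝ} (hω : ω ≠ 0) :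
    sechWeight ω = 4 * (π / 2 * |ω| / sinh (π / 2 * |ω|)) := by
  rw [sechWeight, if_neg hω]
  rcases abs_cases ω with ⟨h, _⟩ | ⟨h, _⟩
  · rw [h]; ring
  · rw [h, show π / 2 * -ω = -(π / 2 * ω) by ring, sinh_neg, neg_div_neg_eq]; ring

theorem sechWeight_neg_one : sechWeight (-1) = 2 * π / sinh (π / 2) := by
  rw [sechWeight_of_ne_zero (by norm_num), abs_neg, abs_one, mul_one]
  ring

theorem self_div_sinh_le {x : ℝ} (hx : 0 < x) : x / sinh x ≤ (1 + 2 * x) * exp (-x) := by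
  rw [div_le_iff₀ (sinh_pos_iff.2 hx), sinh_eq]
  have h1 : exp (-x) * exp x = 1 := by rw [← exp_add, neg_add_cancel, exp_zero]
  have h2 : (1 + 2 * x) * (exp (-x) * exp (-x)) ≤ 1 := by
    calc (1 + 2 * x) * (exp (-x) * exp (-x)) ≤ exp (2 * x) * (exp (-x) * exp (-x)) := by
          gcongr
          linarith [add_one_le_exp (2 * x)]
      _ = 1 := by
          rw [← exp_add, ← exp_add, ← exp_zero]
          ring_nf
  linear_combination (1 / 2) * h2 - (1 / 2) * (1 + 2 * x) * h1

theorem le_self_div_sinh {x : ℝ} (hx : 0 < x) : (1 + 2 * x) * exp (-x) / 2 ≤ x / sinh x := by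
  rw [le_div_iff₀ (sinh_pos_iff.2 hx), sinh_eq]
  have h1 : exp (-x) * exp x = 1 := by rw [← exp_add, neg_add_cancel, exp_zero]
  have h2 : 1 - 2 * x ≤ exp (-x) * exp (-x) := by
    rw [← exp_add]
    linarith [add_one_le_exp (-x + -x)]
  have h3 : 0 ≤ x * (exp (-x) * exp (-x)) := by positivity
  linear_combination (1 / 4) * h2 + (1 / 2) * h3 + (1 / 4) * (1 + 2 * x) * h1

theorem sechWeight_le (ω : ℝ) :
    sechWeight ω ≤ 4 * ((1 + 2 * (π / 2 * |ω|)) * exp (-(π / 2 * |ω|))) := by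
  rcases eq_or_ne ω 0 with rfl | hω
  · simp [sechWeight]
  · rw [sechWeight_of_ne_zero hω]
    gcongr
    exact self_div_sinh_le (by positivity)

theorem le_sechWeight (ω : ℝ) :
    2 * ((1 + 2 * (π / 2 * |ω|)) * exp (-(π / 2 * |ω|))) ≤ sechWeight ω := by
  rcases eq_or_ne ω 0 with rfl | hω
  · norm_num [sechWeight]
  · rw [sechWeight_of_ne_zero hω]
    linarith [le_self_div_sinh (x := π / 2 * |ω|) (by positivity)]

theorem sechWeight_pos (ω : ℝ) : 0 < sechWeight ω :=
  lt_of_lt_of_le (by positivity) (le_sechWeight ω)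

theorem sechWeight_le_four (ω : ℝ) : sechWeight ω ≤ 4 := by
  rcases eq_or_ne ω 0 with rfl | hω
  · simp [sechWeight]
  · rw [sechWeight_of_ne_zero hω]
    have hx : 0 < π / 2 * |ω| := by positivity
    have : π / 2 * |ω| / sinh (π / 2 * |ω|) ≤ 1 :=
      (div_le_one (sinh_pos_iff.2 hx)).2 (self_le_sinh_iff.2 hx.le)
    linarith

theorem two_le_sechWeight_neg_one : 2 ≤ sechWeight (-1) := by
  rw [sechWeight_neg_one, le_div_iff₀ (sinh_pos_iff.2 (by positivity))]
  linarith [sinh_half_pi_le, pi_gt_three]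

theorem one_add_pow_three_le {x : ℝ} (hx : 0 ≤ x) : (1 + x) ^ 3 ≤ 27 * exp x :=
  calc (1 + x) ^ 3 ≤ (3 * exp (x / 3)) ^ 3 := by
        gcongr
        linarith [add_one_le_exp (x / 3)]
    _ = 27 * exp x := by
        rw [mul_pow, ← exp_nat_mul]
        norm_num
        ring_nf

theorem one_add_abs_sq_mul_sechWeight_le (ω : ℝ) : (1 + |ω|) ^ 2 * sechWeight ω ≤ 216 := by
  set x := π / 2 * |ω| with hx
  have hx0 : 0 ≤ x := by positivity
  have hωx : |ω| ≤ x := le_mul_of_one_le_left (abs_nonneg _) (by linarith [pi_gt_three])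
  have hω := (sechWeight_pos ω).le
  calc (1 + |ω|) ^ 2 * sechWeight ω ≤ (1 + x) ^ 2 * (4 * ((2 * (1 + x)) * exp (-x))) := by
        gcongr
        refine (sechWeight_le ω).trans ?_
        rw [← hx]
        gcongr
        linarith
    _ = 8 * ((1 + x) ^ 3 * exp (-x)) := by ring
    _ ≤ 8 * (27 * exp x * exp (-x)) := by
        gcongr
        exact one_add_pow_three_le hx0
    _ = 216 := by
        rw [mul_assoc, ← exp_add, add_neg_cancel, exp_zero]
        norm_num

theorem exp_half_pi_le : exp (π / 2) ≤ 4.82 := by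
  have hsinh := sinh_half_pi_le
  have hcosh : cosh (π / 2) ≤ 2.51 := by
    refine le_of_sq_le_sq ?_ (by norm_num)
    have hpos : 0 ≤ sinh (π / 2) := sinh_nonneg_iff.2 (by positivity)
    rw [cosh_sq]
    nlinarith
  rw [← cosh_add_sinh]
  linarith

theorem one_add_two_mul_mul_exp_neg_le {x y d : ℝ} (hx : 0 ≤ x) (hd : 0 ≤ d)
    (hxy : x ≤ y + d) :
    (1 + 2 * y) * exp (-y) ≤ 2 * exp d * ((1 + 2 * x) * exp (-x)) := by
  have hd' : 1 ≤ exp d := one_le_exp hd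
  rcases le_total x y with h | h
  · have h1 : 1 + 2 * y ≤ (1 + 2 * x) * (2 * exp (y - x)) := by
      nlinarith [add_one_le_exp (y - x)]
    calc (1 + 2 * y) * exp (-y) ≤ (1 + 2 * x) * (2 * exp (y - x)) * exp (-y) := by gcongr
      _ = 2 * 1 * ((1 + 2 * x) * exp (-x)) := by
          rw [show -x = (y - x) + -y by ring, exp_add]
          ring
      _ ≤ _ := by gcongr
  · calc (1 + 2 * y) * exp (-y) ≤ (1 + 2 * x) * exp (d + -x) := by
          gcongr
          linarith
      _ = 1 * exp d * ((1 + 2 * x) * exp (-x)) := by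
          rw [exp_add]
          ring
      _ ≤ _ := by
          gcongr
          norm_num

theorem sechWeight_mul_sub_le {k : ℕ} (hk : k ≠ 0) (l : ℕ) (I : ℝ) :
    sechWeight (k * I - l) ≤ 4 * 5 ^ l * sechWeight I := by
  have hI : |I| ≤ |k * I - l| + l := by
    have hk' : (1 : ℝ) ≤ k := Nat.one_le_cast.2 (Nat.one_le_iff_ne_zero.2 hk)
    calc |I| ≤ k * |I| := le_mul_of_one_le_left (abs_nonneg _) hk'
      _ = |(k * I - l) + l| := by rw [sub_add_cancel, abs_mul, Nat.abs_cast]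
      _ ≤ |k * I - l| + l := (abs_add_le _ _).trans_eq (by rw [Nat.abs_cast])
  have hshift := one_add_two_mul_mul_exp_neg_le (x := π / 2 * |I|) (y := π / 2 * |k * I - l|)
    (d := l * (π / 2)) (by positivity) (by positivity)
    (by linarith [mul_le_mul_of_nonneg_left hI (by positivity : 0 ≤ π / 2)])
  have hexp : exp (l * (π / 2)) ≤ 5 ^ l := by
    rw [exp_nat_mul]
    gcongr
    exact exp_half_pi_le.trans (by norm_num)
  calc sechWeight (k * I - l)
      ≤ 4 * (2 * exp (l * (π / 2)) * ((1 + 2 * (π / 2 * |I|)) * exp (-(π / 2 * |I|)))) := by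
        linarith [sechWeight_le (k * I - l)]
    _ = 4 * exp (l * (π / 2)) * (2 * ((1 + 2 * (π / 2 * |I|)) * exp (-(π / 2 * |I|)))) := by ring
    _ ≤ 4 * 5 ^ l * sechWeight I := by
        gcongr
        exact le_sechWeight I

theorem sq_mul_sechWeight_le (I : ℝ) : I ^ 2 * sechWeight I ≤ kappa * sechWeight (-1) := by
  have hκ := kappa_bounds.1
  rcases eq_or_ne I 0 with rfl | hI
  · have := sechWeight_pos (-1)
    simp only [ne_eq, OfNat.ofNat_ne_zero, not_false_eq_true, zero_pow, zero_mul]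
    positivity
  · have hJ : 0 < |I| := abs_pos.2 hI
    have h : |I| ^ 3 * sinh (π / 2) / sinh (π / 2 * |I|) ≤ kappa :=
      le_csSup bddAbove_kappa ⟨|I|, hJ, rfl⟩
    rw [sechWeight_neg_one, sechWeight_of_ne_zero hI, ← sq_abs]
    calc |I| ^ 2 * (4 * (π / 2 * |I| / sinh (π / 2 * |I|)))
        = |I| ^ 3 * sinh (π / 2) / sinh (π / 2 * |I|) * (2 * π / sinh (π / 2)) := by
          field_simp
          ring
      _ ≤ _ := by gcongr

theorem sinh_three_quarters_pi_le : sinh (π / 2 * (3 / 2)) ≤ 5.3 := by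
  have hexp : exp (π / 2 * (3 / 2)) ≤ 10.6 := by
    refine le_of_sq_le_sq ?_ (by norm_num)
    calc exp (π / 2 * (3 / 2)) ^ 2 = exp (π / 2) ^ 3 := by
          rw [← exp_nat_mul, ← exp_nat_mul]
          ring_nf
      _ ≤ 4.82 ^ 3 := by
          gcongr
          exact exp_half_pi_le
      _ ≤ 10.6 ^ 2 := by norm_num
  rw [sinh_eq]
  linarith [exp_pos (-(π / 2 * (3 / 2)))]

-- The value `J = 3/2` is close to the maximizer in `kappa`.
theorem sinh_half_pi_mul_two_div_pi_le_kappa : sinh (π / 2) * 2 / π ≤ kappa := by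
  have hκ : (3 / 2 : ℝ) ^ 3 * sinh (π / 2) / sinh (π / 2 * (3 / 2)) ≤ kappa :=
    le_csSup bddAbove_kappa ⟨3 / 2, by norm_num, rfl⟩
  refine le_trans ?_ hκ
  have hs : 0 < sinh (π / 2) := sinh_pos_iff.2 (by positivity)
  have h := mul_le_mul_of_nonneg_left sinh_three_quarters_pi_le hs.le
  rw [div_le_div_iff₀ pi_pos (sinh_pos_iff.2 (by positivity))]
  nlinarith [pi_gt_d4]

theorem abs_mul_sechWeight_le (I : ℝ) : |I| * sechWeight I ≤ kappa * sechWeight (-1) := by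
  have hI := (sechWeight_pos I).le
  rcases le_total 1 |I| with h | h
  · refine le_trans ?_ (sq_mul_sechWeight_le I)
    rw [← sq_abs]
    gcongr
    exact le_self_pow₀ h two_ne_zero
  · calc |I| * sechWeight I ≤ 1 * 4 := by
          gcongr
          exact sechWeight_le_four I
      _ = sinh (π / 2) * 2 / π * sechWeight (-1) := by
          rw [sechWeight_neg_one]
          field_simp
          norm_num
      _ ≤ _ := by
          gcongr
          · exact (sechWeight_pos _).le
          · exact sinh_half_pi_mul_two_div_pi_le_kappa

theorem HasPartials.exists_hasDerivAt_implicit {f f₁ f₂ : ℝ × ℝ → ℝ} (hf : HasPartials f f₁ f₂)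
    (hf₁ : Continuous f₁) (hf₂ : Continuous f₂) {u : ℝ × ℝ} (hu : f₂ u ≠ 0) :
    ∃ ζ : ℝ → ℝ, HasDerivAt ζ (-(f₁ u / f₂ u)) u.1 ∧ Tendsto ζ (𝓝 u.1) (𝓝 u.2) ∧
      ∀ᶠ x in 𝓝 u.1, f (x, ζ x) = f u := by
  set f' := f₁ u • ContinuousLinearMap.fst ℝ ℝ ℝ + f₂ u • ContinuousLinearMap.snd ℝ ℝ ℝ with hf'
  have hstrict : HasStrictFDerivAt f f' u :=
    hasStrictFDerivAt_of_hasFDerivAt_of_continuousAt (Eventually.of_forall hf)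
      ((hf₁.smul continuous_const).add (hf₂.smul continuous_const)).continuousAt
  have e1 : (f' ∘L ContinuousLinearMap.inr ℝ ℝ ℝ) ∘L ((f₂ u)⁻¹ • ContinuousLinearMap.id ℝ ℝ)
      = ContinuousLinearMap.id ℝ ℝ := by
    ext; simp [hf', hu]
  have e2 : ((f₂ u)⁻¹ • ContinuousLinearMap.id ℝ ℝ) ∘L (f' ∘L ContinuousLinearMap.inr ℝ ℝ ℝ)
      = ContinuousLinearMap.id ℝ ℝ := by
    ext; simp [hf', hu]
  have hinv : (f' ∘L ContinuousLinearMap.inr ℝ ℝ ℝ).IsInvertible :=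
    ⟨ContinuousLinearEquiv.equivOfInverse' _ _ e1 e2, rfl⟩
  refine ⟨hstrict.implicitFunctionOfProdDomain hinv, ?_,
    hstrict.tendsto_implicitFunctionOfProdDomain hinv,
    hstrict.eventually_apply_implicitFunctionOfProdDomain hinv⟩
  have h := (hstrict.hasStrictFDerivAt_implicitFunctionOfProdDomain hinv).hasFDerivAt
  rw [ContinuousLinearMap.inverse_eq e1 e2] at h
  refine h.hasDerivAt.congr_deriv ?_
  simp [hf']
  ring

theorem abs_le_arcsin_iff {c s : ℝ} (hs : |s| ≤ π / 2) : |s| ≤ arcsin c ↔ |sin s| ≤ c := by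
  rw [abs_sin_eq_sin_abs_of_abs_le_pi (by linarith [pi_pos])]
  exact le_arcsin_iff_sin_le' ⟨by linarith [abs_nonneg s, pi_pos], hs⟩

theorem mul_abs_sub_le_abs_sin_sub {S : Set ℝ} {c x y : ℝ} (hS : Convex ℝ S)
    (hc : ∀ s ∈ S, c ≤ cos s) (hx : x ∈ S) (hy : y ∈ S) : c * |x - y| ≤ |sin x - sin y| := by
  have hmv := hS.mul_sub_le_image_sub_of_le_deriv continuous_sin.continuousOn
    differentiable_sin.differentiableOn (C := c)
    fun s hs => by rw [Real.deriv_sin]; exact hc s (interior_subset hs)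
  rcases le_total y x with h | h
  · rw [abs_of_nonneg (sub_nonneg.2 h)]
    exact (hmv y hy x hx h).trans (le_abs_self _)
  · rw [abs_sub_comm, abs_of_nonneg (sub_nonneg.2 h), abs_sub_comm]
    exact (hmv x hx y hy h).trans (le_abs_self _)

/-- A doubly periodic `C¹` function `G` of two angles which is `C¹`-close to `-(a sin φ + sin s)`,
where `|a|` and `|I a|` are at most `q < 1`. This is the form of the equation of the crest; the
number `a` is the paper's `α(I)`. -/
structure NearSineSum where
  (G G₁ G₂ : ℝ × ℝ → ℝ)
  (I a q δ : ℝ)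
  q_lt_one : q < 1
  δ_le : δ ≤ (1 - q) ^ 2 / 100
  abs_a_le : |a| ≤ q
  abs_mul_a_le : |I * a| ≤ q
  hasPartials_G : HasPartials G G₁ G₂
  continuous_G₁ : Continuous G₁
  continuous_G₂ : Continuous G₂
  G_add_two_pi_fst : ∀ φ s, G (φ + 2 * π, s) = G (φ, s)
  G_add_two_pi_snd : ∀ φ s, G (φ, s + 2 * π) = G (φ, s)
  G_near : ∀ φ s, |G (φ, s) + (a * sin φ + sin s)| ≤ δ
  G₁_near : ∀ φ s, (1 + |I|) * |G₁ (φ, s) + a * cos φ| ≤ δ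
  G₂_near : ∀ φ s, |G₂ (φ, s) + cos s| ≤ δ

namespace NearSineSum

variable (P : NearSineSum)

theorem q_nonneg : 0 ≤ P.q := (abs_nonneg _).trans P.abs_a_le

theorem δ_nonneg : 0 ≤ P.δ := (abs_nonneg _).trans (P.G_near 0 0)

theorem δ_le_linear : P.δ ≤ (1 - P.q) / 100 := by
  have := P.δ_le
  nlinarith [P.q_nonneg, P.q_lt_one]

theorem continuous_G_snd (φ : ℝ) : Continuous fun s => P.G (φ, s) :=
  P.hasPartials_G.continuous.comp (by fun_prop)

theorem abs_a_mul_le {x : ℝ} (hx : |x| ≤ 1) : |P.a * x| ≤ P.q := by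
  rw [abs_mul]
  exact (mul_le_of_le_one_right (abs_nonneg _) hx).trans P.abs_a_le

theorem abs_sin_le_of_G_eq_zero {φ s : ℝ} (h : P.G (φ, s) = 0) : |sin s| ≤ (1 + P.q) / 2 := by
  have hG := P.G_near φ s
  rw [h, zero_add] at hG
  calc |sin s| = |(P.a * sin φ + sin s) - P.a * sin φ| := by rw [add_sub_cancel_left]
    _ ≤ P.δ + P.q := (abs_sub _ _).trans (add_le_add hG (P.abs_a_mul_le (abs_sin_le_one φ)))
    _ ≤ _ := by linarith [P.δ_le_linear, P.q_lt_one]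

theorem le_cos_sq {s : ℝ} (h : |sin s| ≤ (1 + P.q) / 2) : (1 - P.q) / 2 ≤ cos s ^ 2 := by
  have hsin : sin s ^ 2 ≤ ((1 + P.q) / 2) ^ 2 := by
    rw [← sq_abs]
    gcongr
  nlinarith [sin_sq_add_cos_sq s, P.q_nonneg, P.q_lt_one]

theorem le_cos {s : ℝ} (hs : |s| ≤ π / 2) (h : |sin s| ≤ (1 + P.q) / 2) :
    (1 - P.q) / 2 ≤ cos s := by
  have h0 : 0 ≤ cos s := cos_nonneg_of_mem_Icc (abs_le.1 hs)
  nlinarith [cos_le_one s, P.le_cos_sq h]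

theorem G₂_neg {φ s : ℝ} (hs : |s| ≤ π / 2) (h : |sin s| ≤ (1 + P.q) / 2) : P.G₂ (φ, s) < 0 := by
  linarith [P.le_cos hs h, (abs_le.1 (P.G₂_near φ s)).2, P.δ_le_linear, P.q_lt_one]

theorem strictAntiOn_G (φ : ℝ) : StrictAntiOn (fun s => P.G (φ, s))
    (Set.Icc (-arcsin ((1 + P.q) / 2)) (arcsin ((1 + P.q) / 2))) := by
  refine strictAntiOn_of_deriv_neg (convex_Icc _ _) (P.continuous_G_snd φ).continuousOn
    fun s hs => ?_
  rw [(P.hasPartials_G.hasDerivAt_snd φ s).deriv]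
  have hmem := interior_subset hs
  have hs' := abs_le.2 ⟨hmem.1, hmem.2⟩
  have hs'' := hs'.trans (arcsin_le_pi_div_two _)
  exact P.G₂_neg hs'' ((abs_le_arcsin_iff hs'').1 hs')

theorem existsUnique_zero (φ : ℝ) : ∃! s, |s| < π / 2 ∧ P.G (φ, s) = 0 := by
  have hq := P.q_nonneg
  have hq' := P.q_lt_one
  have hδ := P.δ_le_linear
  have hsin : sin (arcsin ((1 + P.q) / 2)) = (1 + P.q) / 2 :=
    sin_arcsin (by linarith) (by linarith)
  have ha := abs_le.1 (P.abs_a_mul_le (abs_sin_le_one φ))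
  set s₁ := arcsin ((1 + P.q) / 2)
  have hs₁ : 0 ≤ s₁ := arcsin_nonneg.2 (by linarith)
  have hs₁_lt : s₁ < π / 2 := arcsin_lt_pi_div_two.2 (by linarith)
  have hright : P.G (φ, s₁) ≤ 0 := by
    have := (abs_le.1 (P.G_near φ s₁)).2
    rw [hsin] at this
    linarith
  have hleft : 0 ≤ P.G (φ, -s₁) := by
    have := (abs_le.1 (P.G_near φ (-s₁))).1
    rw [sin_neg, hsin] at this
    linarith
  obtain ⟨s, hs, hGs⟩ := intermediate_value_Icc' (by linarith) (P.continuous_G_snd φ).continuousOn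
    ⟨hright, hleft⟩
  refine ⟨s, ⟨(abs_le.2 hs).trans_lt hs₁_lt, hGs⟩, ?_⟩
  rintro t ⟨ht, hGt⟩
  have ht' := (abs_le_arcsin_iff ht.le).2 (P.abs_sin_le_of_G_eq_zero hGt)
  exact (P.strictAntiOn_G φ).injOn (abs_le.1 ht') hs (hGt.trans hGs.symm)

/-- The zero `s = ξ(φ)` of `G(φ,·)` in `(-π/2, π/2)`; its graph is the crest. -/
def ξ (φ : ℝ) : ℝ := (P.existsUnique_zero φ).choose

theorem abs_ξ_lt (φ : ℝ) : |P.ξ φ| < π / 2 := (P.existsUnique_zero φ).choose_spec.1.1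

theorem G_ξ (φ : ℝ) : P.G (φ, P.ξ φ) = 0 := (P.existsUnique_zero φ).choose_spec.1.2

theorem eq_ξ {φ s : ℝ} (hs : |s| < π / 2) (h : P.G (φ, s) = 0) : s = P.ξ φ :=
  (P.existsUnique_zero φ).choose_spec.2 s ⟨hs, h⟩

theorem cos_ξ_pos (φ : ℝ) : 0 < cos (P.ξ φ) := cos_pos_of_mem_Ioo (abs_lt.1 (P.abs_ξ_lt φ))

theorem le_cos_ξ (φ : ℝ) : (1 - P.q) / 2 ≤ cos (P.ξ φ) :=
  P.le_cos (P.abs_ξ_lt φ).le (P.abs_sin_le_of_G_eq_zero (P.G_ξ φ))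

theorem ξ_periodic : Function.Periodic P.ξ (2 * π) := fun φ =>
  P.eq_ξ (P.abs_ξ_lt _) (by rw [← P.G_add_two_pi_fst, P.G_ξ])

/-- The derivative of `ξ`. -/
def ξ' (φ : ℝ) : ℝ := -(P.G₁ (φ, P.ξ φ) / P.G₂ (φ, P.ξ φ))

theorem G₂_ξ_neg (φ : ℝ) : P.G₂ (φ, P.ξ φ) < 0 :=
  P.G₂_neg (P.abs_ξ_lt φ).le (P.abs_sin_le_of_G_eq_zero (P.G_ξ φ))

theorem hasDerivAt_ξ (φ : ℝ) : HasDerivAt P.ξ (P.ξ' φ) φ := by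
  obtain ⟨ζ, hζ', hζ, hGζ⟩ := P.hasPartials_G.exists_hasDerivAt_implicit P.continuous_G₁
    P.continuous_G₂ (u := (φ, P.ξ φ)) (P.G₂_ξ_neg φ).ne
  refine hζ'.congr_of_eventuallyEq ?_
  filter_upwards [hGζ, hζ.abs.eventually_lt_const (P.abs_ξ_lt φ)] with x hx hx'
  exact (P.eq_ξ hx' (hx.trans (P.G_ξ φ))).symm

theorem continuous_ξ : Continuous P.ξ :=
  continuous_iff_continuousAt.2 fun x => (P.hasDerivAt_ξ x).continuousAt

theorem continuous_ξ' : Continuous P.ξ' :=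
  ((P.continuous_G₁.comp (continuous_id.prodMk P.continuous_ξ)).div
    (P.continuous_G₂.comp (continuous_id.prodMk P.continuous_ξ)) fun φ => (P.G₂_ξ_neg φ).ne).neg

theorem abs_sin_ξ_add_le (φ : ℝ) : |sin (P.ξ φ) + P.a * sin φ| ≤ P.δ := by
  have h := P.G_near φ (P.ξ φ)
  rwa [P.G_ξ, zero_add, add_comm] at h

theorem abs_ξ_add_arcsin_le (φ : ℝ) :
    |P.ξ φ + arcsin (P.a * sin φ)| ≤ 2 / (1 - P.q) * |sin (P.ξ φ) + P.a * sin φ| := by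
  have hq := P.q_lt_one
  set s₁ := arcsin ((1 + P.q) / 2)
  have hbound := P.abs_a_mul_le (abs_sin_le_one φ)
  have hsin : sin (-arcsin (P.a * sin φ)) = -(P.a * sin φ) := by
    rw [sin_neg, sin_arcsin] <;> linarith [abs_le.1 hbound]
  have hcos : ∀ s ∈ Set.Icc (-s₁) s₁, (1 - P.q) / 2 ≤ cos s := fun s hs => by
    have hs' := (abs_le.2 hs).trans (arcsin_le_pi_div_two _)
    exact P.le_cos hs' ((abs_le_arcsin_iff hs').1 (abs_le.2 hs))
  have hξ : P.ξ φ ∈ Set.Icc (-s₁) s₁ := abs_le.1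
    ((abs_le_arcsin_iff (P.abs_ξ_lt φ).le).2 (P.abs_sin_le_of_G_eq_zero (P.G_ξ φ)))
  have harcsin : -arcsin (P.a * sin φ) ∈ Set.Icc (-s₁) s₁ := by
    have habs : |-arcsin (P.a * sin φ)| ≤ π / 2 := by
      rw [abs_neg]
      exact abs_le.2 ⟨neg_pi_div_two_le_arcsin _, arcsin_le_pi_div_two _⟩
    refine abs_le.1 ((abs_le_arcsin_iff habs).2 ?_)
    rw [hsin, abs_neg]
    linarith
  have h := mul_abs_sub_le_abs_sin_sub (convex_Icc _ _) hcos hξ harcsin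
  rw [hsin, sub_neg_eq_add, sub_neg_eq_add] at h
  rw [div_mul_eq_mul_div, le_div_iff₀ (by linarith)]
  linarith

theorem G_ξ_add (φ : ℝ) (n : ℤ) : P.G (φ, P.ξ φ + n * (2 * π)) = 0 :=
  ((show Function.Periodic (fun s => P.G (φ, s)) (2 * π) from
    P.G_add_two_pi_snd φ).int_mul n (P.ξ φ)).trans (P.G_ξ φ)

theorem exists_eq_ξ_add {φ s : ℝ} (h : P.G (φ, s) = 0) (hs : 0 < cos s) :
    ∃ n : ℤ, s = P.ξ φ + n * (2 * π) := by
  obtain ⟨n, hn, -⟩ := existsUnique_add_zsmul_mem_Ioc two_pi_pos s (-π)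
  rw [zsmul_eq_mul] at hn
  set t := s + n * (2 * π) with ht
  have hG : P.G (φ, t) = 0 :=
    ((show Function.Periodic (fun s => P.G (φ, s)) (2 * π) from
      P.G_add_two_pi_snd φ).int_mul n s).trans h
  have hcos : 0 < cos |t| := by rwa [cos_abs, ht, cos_add_int_mul_two_pi]
  have habs : |t| ≤ π := abs_le.2 ⟨hn.1.le, by linarith [hn.2]⟩
  have hlt : |t| < π / 2 := by
    by_contra! hle
    exact hcos.not_ge (cos_nonpos_of_pi_div_two_le_of_le hle (by linarith [pi_pos]))
  refine ⟨-n, ?_⟩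
  rw [← P.eq_ξ hlt hG, ht]
  push_cast
  ring

theorem abs_sin_ξ_le (φ : ℝ) : |sin (P.ξ φ)| ≤ |sin φ| + P.δ :=
  calc |sin (P.ξ φ)| = |(sin (P.ξ φ) + P.a * sin φ) - P.a * sin φ| := by rw [add_sub_cancel_right]
    _ ≤ P.δ + |P.a| * |sin φ| := by
        rw [← abs_mul]
        exact (abs_sub _ _).trans (by gcongr; exact P.abs_sin_ξ_add_le φ)
    _ ≤ P.δ + 1 * |sin φ| := by
        gcongr
        exact P.abs_a_le.trans P.q_lt_one.le
    _ = |sin φ| + P.δ := by ring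

theorem cos_ξ_mul_abs_cos_le (φ : ℝ) :
    cos (P.ξ φ) * |cos φ| ≤ cos (P.ξ φ) ^ 2 + 2 * P.δ := by
  have hδ := P.δ_nonneg
  have hcos := P.cos_ξ_pos φ
  have hsin : sin (P.ξ φ) ^ 2 ≤ (|sin φ| + P.δ) ^ 2 := by
    rw [← sq_abs]
    gcongr
    exact P.abs_sin_ξ_le φ
  have hsq : cos φ ^ 2 ≤ cos (P.ξ φ) ^ 2 + 3 * P.δ := by
    nlinarith [sin_sq_add_cos_sq φ, sin_sq_add_cos_sq (P.ξ φ), abs_nonneg (sin φ),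
      sq_abs (sin φ), abs_sin_le_one φ, P.q_nonneg]
  refine le_of_sq_le_sq ?_ (by positivity)
  rw [mul_pow, sq_abs]
  nlinarith [mul_le_mul_of_nonneg_left hsq (sq_nonneg (cos (P.ξ φ))),
    mul_nonneg hδ (sq_nonneg (cos (P.ξ φ)))]

theorem cos_ξ_sub_le_abs_G₂ (φ : ℝ) : cos (P.ξ φ) - P.δ ≤ |P.G₂ (φ, P.ξ φ)| := by
  rw [abs_of_neg (P.G₂_ξ_neg φ)]
  linarith [(abs_le.1 (P.G₂_near φ (P.ξ φ))).2]

theorem abs_mul_G₁_le (φ s : ℝ) : |P.I * P.G₁ (φ, s)| ≤ P.q * |cos φ| + P.δ :=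
  calc |P.I * P.G₁ (φ, s)| = |P.I * (P.G₁ (φ, s) + P.a * cos φ) - P.I * P.a * cos φ| := by ring_nf
    _ ≤ |P.I| * |P.G₁ (φ, s) + P.a * cos φ| + |P.I * P.a| * |cos φ| := by
        rw [← abs_mul, ← abs_mul]
        exact abs_sub _ _
    _ ≤ P.δ + P.q * |cos φ| := by
        gcongr
        · linarith [P.G₁_near φ s, abs_nonneg (P.G₁ (φ, s) + P.a * cos φ)]
        · exact P.abs_mul_a_le
    _ = _ := add_comm _ _

theorem abs_G₁_le (φ s : ℝ) : |P.G₁ (φ, s)| ≤ P.q + P.δ :=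
  calc |P.G₁ (φ, s)| = |(P.G₁ (φ, s) + P.a * cos φ) - P.a * cos φ| := by rw [add_sub_cancel_right]
    _ ≤ P.δ + P.q := by
        refine (abs_sub _ _).trans (add_le_add ?_ (P.abs_a_mul_le (abs_cos_le_one φ)))
        linarith [P.G₁_near φ s,
          mul_nonneg (abs_nonneg P.I) (abs_nonneg (P.G₁ (φ, s) + P.a * cos φ))]
    _ = _ := add_comm _ _

theorem abs_mul_ξ'_le (φ : ℝ) : |P.I * P.ξ' φ| ≤ (1 + P.q) / 2 := by
  have hδ := P.δ_nonneg
  have hq := P.q_nonneg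
  have hq' := P.q_lt_one
  have hcos := P.cos_ξ_pos φ
  rw [ξ', mul_neg, abs_neg, ← mul_div_assoc, abs_div,
    div_le_iff₀ (abs_pos.2 (P.G₂_ξ_neg φ).ne)]
  suffices P.q * |cos φ| + P.δ ≤ (1 + P.q) / 2 * (cos (P.ξ φ) - P.δ) from
    (P.abs_mul_G₁_le φ _).trans (this.trans (by gcongr; exact P.cos_ξ_sub_le_abs_G₂ φ))
  refine le_of_mul_le_mul_left ?_ hcos
  have h1 := mul_le_mul_of_nonneg_left (P.cos_ξ_mul_abs_cos_le φ) hq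
  have h2 := mul_le_mul_of_nonneg_left (P.le_cos_sq (P.abs_sin_le_of_G_eq_zero (P.G_ξ φ)))
    (by linarith : 0 ≤ (1 - P.q) / 2)
  have h3 : cos (P.ξ φ) * P.δ ≤ P.δ := mul_le_of_le_one_left hδ (cos_le_one _)
  have h4 : P.q * P.δ ≤ P.δ := mul_le_of_le_one_left hδ hq'.le
  have h5 : P.q * (cos (P.ξ φ) * P.δ) ≤ cos (P.ξ φ) * P.δ :=
    mul_le_of_le_one_left (by positivity) hq'.le
  linarith [P.δ_le]

theorem abs_ξ'_le (φ : ℝ) : |P.ξ' φ| ≤ 8 / (1 - P.q) := by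
  have hG₁ := P.abs_G₁_le φ (P.ξ φ)
  have hG₂ := P.cos_ξ_sub_le_abs_G₂ φ
  have hcos := P.le_cos_ξ φ
  have hq := P.q_lt_one
  rw [ξ', abs_neg, abs_div, div_le_div_iff₀ (abs_pos.2 (P.G₂_ξ_neg φ).ne) (by linarith)]
  nlinarith [P.δ_le_linear]

end NearSineSum

namespace NearSineSum

variable (P : NearSineSum)

/-- The projection of the point `(ψ, ξ(ψ))` of the crest to the axis `s = 0` along the lines of
direction `(I, 1)`. -/
def proj (ψ : ℝ) : ℝ := ψ - P.I * P.ξ ψ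

theorem hasDerivAt_proj (ψ : ℝ) : HasDerivAt P.proj (1 - P.I * P.ξ' ψ) ψ :=
  (hasDerivAt_id ψ).sub ((P.hasDerivAt_ξ ψ).const_mul P.I)

theorem one_sub_mul_ξ'_pos (ψ : ℝ) : 0 < 1 - P.I * P.ξ' ψ := by
  linarith [(abs_le.1 (P.abs_mul_ξ'_le ψ)).2, P.q_lt_one]

theorem strictMono_proj : StrictMono P.proj :=
  strictMono_of_deriv_pos fun ψ => by
    rw [(P.hasDerivAt_proj ψ).deriv]
    exact P.one_sub_mul_ξ'_pos ψ

theorem abs_mul_ξ_le (ψ : ℝ) : |P.I * P.ξ ψ| ≤ |P.I| * (π / 2) := by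
  rw [abs_mul]
  exact mul_le_mul_of_nonneg_left (P.abs_ξ_lt ψ).le (abs_nonneg _)

theorem surjective_proj : Function.Surjective P.proj := by
  have hcont : Continuous P.proj :=
    continuous_iff_continuousAt.2 fun ψ => (P.hasDerivAt_proj ψ).continuousAt
  refine hcont.surjective ?_ ?_
  · refine tendsto_atTop_mono (fun ψ => ?_)
      (tendsto_atTop_add_const_right _ (-(|P.I| * (π / 2))) tendsto_id)
    rw [id, proj]
    linarith [(abs_le.1 (P.abs_mul_ξ_le ψ)).2]
  · refine tendsto_atBot_mono (fun ψ => ?_)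
      (tendsto_atBot_add_const_right _ (|P.I| * (π / 2)) tendsto_id)
    rw [id, proj]
    linarith [(abs_le.1 (P.abs_mul_ξ_le ψ)).1]

/-- The inverse of `proj`: the line of direction `(I, 1)` through `(θ, 0)` meets the graph of `ξ`
at `(lift θ, ξ (lift θ))`. -/
def lift : ℝ ≃o ℝ := (P.strictMono_proj.orderIsoOfSurjective P.proj P.surjective_proj).symm

theorem proj_lift (θ : ℝ) : P.proj (P.lift θ) = θ :=
  (P.strictMono_proj.orderIsoOfSurjective P.proj P.surjective_proj).apply_symm_apply θ

theorem lift_proj (ψ : ℝ) : P.lift (P.proj ψ) = ψ :=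
  P.strictMono_proj.injective (P.proj_lift _)

theorem proj_add_two_pi (ψ : ℝ) : P.proj (ψ + 2 * π) = P.proj ψ + 2 * π := by
  rw [proj, proj, P.ξ_periodic ψ]
  ring

theorem lift_add_two_pi (θ : ℝ) : P.lift (θ + 2 * π) = P.lift θ + 2 * π :=
  P.strictMono_proj.injective (by rw [proj_lift, proj_add_two_pi, proj_lift])

theorem lift_mem_Ioo {u v θ : ℝ} (hθ : θ ∈ Set.Ioo (P.proj u) (P.proj v)) :
    P.lift θ ∈ Set.Ioo u v := by
  rw [← P.proj_lift θ] at hθ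
  exact ⟨P.strictMono_proj.lt_iff_lt.1 hθ.1, P.strictMono_proj.lt_iff_lt.1 hθ.2⟩

theorem hasDerivAt_lift (θ : ℝ) : HasDerivAt P.lift (1 - P.I * P.ξ' (P.lift θ))⁻¹ θ :=
  HasDerivAt.of_local_left_inverse P.lift.continuous.continuousAt (P.hasDerivAt_proj _)
    (P.one_sub_mul_ξ'_pos _).ne' (Eventually.of_forall P.proj_lift)

/-- The graph of `ξ` modulo `2π` in the second angle. -/
def liftedGraph : Set (ℝ × ℝ) := {x | ∃ n : ℤ, x.2 = P.ξ x.1 + n * (2 * π)}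

/-- The parameter `τ` at which the line `τ ↦ (φ - Iτ, s - τ)` meets the graph of `ξ`. -/
def crossing (φ s : ℝ) : ℝ := s - P.ξ (P.lift (φ - P.I * s))

theorem sub_mul_crossing (φ s : ℝ) : φ - P.I * P.crossing φ s = P.lift (φ - P.I * s) := by
  have h := P.proj_lift (φ - P.I * s)
  rw [proj] at h
  rw [crossing]
  linarith

theorem sub_crossing (φ s : ℝ) : s - P.crossing φ s = P.ξ (P.lift (φ - P.I * s)) := by
  rw [crossing, sub_sub_cancel]

theorem crossing_mem (φ s : ℝ) :
    (φ - P.I * P.crossing φ s, s - P.crossing φ s) ∈ P.liftedGraph := by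
  rw [sub_mul_crossing, sub_crossing]
  exact ⟨0, by simp⟩

theorem eq_crossing {φ s τ : ℝ} (h : s - τ = P.ξ (φ - P.I * τ)) : τ = P.crossing φ s := by
  have hlift : P.lift (φ - P.I * s) = φ - P.I * τ := by
    rw [← P.lift_proj (φ - P.I * τ), proj, ← h]
    ring_nf
  rw [crossing, hlift, ← h, sub_sub_cancel]

theorem abs_crossing_lt_pi {φ s : ℝ} (hs : |s| ≤ π / 2) : |P.crossing φ s| < π :=
  (abs_sub _ _).trans_lt (by linarith [P.abs_ξ_lt (P.lift (φ - P.I * s))])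

theorem abs_crossing_lt {φ s τ : ℝ} (hs : |s| ≤ π / 2)
    (h : (φ - P.I * τ, s - τ) ∈ P.liftedGraph) (hne : τ ≠ P.crossing φ s) :
    |P.crossing φ s| < |τ| := by
  obtain ⟨n, hn : s - τ = P.ξ (φ - P.I * τ) + n * (2 * π)⟩ := h
  have hn0 : n ≠ 0 := by
    rintro rfl
    exact hne (P.eq_crossing (by simpa using hn))
  have hperiod : 2 * π ≤ |n * (2 * π)| := by
    rw [abs_mul, abs_of_pos two_pi_pos]
    exact le_mul_of_one_le_left two_pi_pos.le (mod_cast Int.one_le_abs hn0)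
  have htri : |n * (2 * π)| ≤ |s| + |τ| + |P.ξ (φ - P.I * τ)| := by
    rw [show n * (2 * π) = s - τ - P.ξ (φ - P.I * τ) by linarith]
    exact (abs_sub _ _).trans (by gcongr; exact abs_sub _ _)
  linarith [P.abs_crossing_lt_pi (φ := φ) hs, P.abs_ξ_lt (φ - P.I * τ)]

theorem isLeast_iff_eq_crossing {φ s τ : ℝ} (hs : |s| ≤ π / 2) :
    ((φ - P.I * τ, s - τ) ∈ P.liftedGraph ∧
      ∀ τ', (φ - P.I * τ', s - τ') ∈ P.liftedGraph → |τ| ≤ |τ'|) ↔ τ = P.crossing φ s := by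
  constructor
  · rintro ⟨hτ, hmin⟩
    by_contra hne
    exact (hmin _ (P.crossing_mem φ s)).not_gt (P.abs_crossing_lt hs hτ hne)
  · rintro rfl
    refine ⟨P.crossing_mem φ s, fun τ' hτ' => ?_⟩
    rcases eq_or_ne τ' (P.crossing φ s) with rfl | hne
    exacts [le_rfl, (P.abs_crossing_lt hs hτ' hne).le]

end NearSineSum

/-- A doubly periodic `C²` function `L`, close to `const + A cos φ + B cos s`, for which the
equation `I L₁ + L₂ = 0` is, up to the factor `B`, of the form `NearSineSum`. This is how the
Melnikov potential enters the geometric part of the argument. -/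
structure NearCosineSum extends NearSineSum where
  (L L₁ L₂ L₁₁ L₁₂ : ℝ × ℝ → ℝ)
  (A B : ℝ)
  A_pos : 0 < A
  B_pos : 0 < B
  hasPartials_L : HasPartials L L₁ L₂
  hasPartials_L₁ : HasPartials L₁ L₁₁ L₁₂
  continuous_L₁₁ : Continuous L₁₁
  continuous_L₁₂ : Continuous L₁₂
  mul_G_eq : ∀ x, B * G x = I * L₁ x + L₂ x
  L_add_two_pi_fst : ∀ φ s, L (φ + 2 * π, s) = L (φ, s)
  L_add_two_pi_snd : ∀ φ s, L (φ, s + 2 * π) = L (φ, s)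
  L₁_add_two_pi_fst : ∀ φ s, L₁ (φ + 2 * π, s) = L₁ (φ, s)
  L_near : ∀ φ s, |L (φ, s) - L (φ, 0) - B * (cos s - 1)| ≤ δ * B
  L₁_near : ∀ φ s, |L₁ (φ, s) + A * sin φ| ≤ δ * A
  L₁₁_near : ∀ φ s, |L₁₁ (φ, s) + A * cos φ| ≤ δ * A
  L₁₂_near : ∀ φ s, |L₁₂ (φ, s)| ≤ δ * A

namespace NearCosineSum

variable (P : NearCosineSum)

theorem exists_isMax : ∃ m : ℝ × ℝ, ∀ y, P.L y ≤ P.L m := by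
  obtain ⟨m, -, hm⟩ := (isCompact_Icc.prod isCompact_Icc :
    IsCompact (Set.Icc (0 : ℝ) (2 * π) ×ˢ Set.Icc (0 : ℝ) (2 * π))).exists_isMaxOn
      ⟨(0, 0), by simp [pi_pos.le]⟩ P.hasPartials_L.continuous.continuousOn
  refine ⟨m, fun y => ?_⟩
  obtain ⟨φ, hφ, hL₁⟩ := Function.Periodic.exists_mem_Ico₀ (f := fun φ => P.L (φ, y.2))
    (fun φ => P.L_add_two_pi_fst φ _) two_pi_pos y.1
  obtain ⟨s, hs, hL₂⟩ := Function.Periodic.exists_mem_Ico₀ (f := fun s => P.L (φ, s))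
    (fun s => P.L_add_two_pi_snd φ s) two_pi_pos y.2
  exact (hL₁.trans hL₂).trans_le (hm ⟨⟨hφ.1, hφ.2.le⟩, hs.1, hs.2.le⟩)

theorem G_eq_zero_of_isMax {m : ℝ × ℝ} (hm : ∀ y, P.L y ≤ P.L m) : P.G m = 0 := by
  have h₁ := IsLocalMax.hasDerivAt_eq_zero (Eventually.of_forall fun φ => hm (φ, m.2))
    (P.hasPartials_L.hasDerivAt_fst m.1 m.2)
  have h₂ := IsLocalMax.hasDerivAt_eq_zero (Eventually.of_forall fun s => hm (m.1, s))
    (P.hasPartials_L.hasDerivAt_snd m.1 m.2)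
  refine (mul_eq_zero.1 ?_).resolve_left P.B_pos.ne'
  rw [P.mul_G_eq, h₁, h₂, mul_zero, add_zero]

theorem cos_pos_of_isMax {m : ℝ × ℝ} (hm : ∀ y, P.L y ≤ P.L m) : 0 < cos m.2 := by
  have h : 0 ≤ P.B * (cos m.2 - 1 + P.δ) := by
    linarith [hm (m.1, 0), (abs_le.1 (P.L_near m.1 m.2)).2]
  linarith [nonneg_of_mul_nonneg_right h P.B_pos, P.δ_le_linear, P.q_nonneg]

/-- `cos s` cannot change sign along a component of `{G = 0}`, because `|sin s|` stays away
from `1` there. -/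
theorem cos_pos_of_mem_connectedComponentIn {m x : ℝ × ℝ} (hm : ∀ y, P.L y ≤ P.L m)
    (hx : x ∈ connectedComponentIn {x | P.G x = 0} m) : 0 < cos x.2 := by
  have himage := (isPreconnected_connectedComponentIn (x := m) (F := {x | P.G x = 0})).image
    (fun x : ℝ × ℝ => cos x.2) (by fun_prop)
  by_contra! hneg
  obtain ⟨y, hy, hy0 : cos y.2 = 0⟩ := himage.ordConnected.out ⟨_, hx, rfl⟩
    ⟨m, mem_connectedComponentIn (P.G_eq_zero_of_isMax hm), rfl⟩
    ⟨hneg, (P.cos_pos_of_isMax hm).le⟩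
  have hG : P.G y = 0 := connectedComponentIn_subset {x | P.G x = 0} m hy
  have h := P.le_cos_sq (P.abs_sin_le_of_G_eq_zero hG)
  rw [hy0] at h
  linarith [P.q_lt_one]

theorem exists_isMax_eq_ξ_add (n : ℤ) :
    ∃ φ, ∀ y, P.L y ≤ P.L (φ, P.ξ φ + n * (2 * π)) := by
  obtain ⟨⟨φ, s⟩, hm⟩ := P.exists_isMax
  obtain ⟨k, rfl⟩ := P.exists_eq_ξ_add (P.G_eq_zero_of_isMax hm) (P.cos_pos_of_isMax hm)
  have hL := (show Function.Periodic (fun s => P.L (φ, s)) (2 * π) from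
    P.L_add_two_pi_snd φ).int_mul (n - k) (P.ξ φ + k * (2 * π))
  refine ⟨φ, fun y => (hm y).trans_eq (hL.symm.trans ?_)⟩
  simp only [Int.cast_sub]
  ring_nf

theorem mem_component_of_isMax_iff {x : ℝ × ℝ} :
    (∃ m, (∀ y, P.L y ≤ P.L m) ∧ x ∈ connectedComponentIn {x | P.G x = 0} m) ↔
      x ∈ P.liftedGraph := by
  constructor
  · rintro ⟨m, hm, hx⟩
    have hG : P.G x = 0 := connectedComponentIn_subset {x | P.G x = 0} m hx
    exact P.exists_eq_ξ_add hG
      (P.cos_pos_of_mem_connectedComponentIn hm hx)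
  · rintro ⟨n, hn⟩
    obtain ⟨φ, hφ⟩ := P.exists_isMax_eq_ξ_add n
    refine ⟨_, hφ, ?_⟩
    have hgraph : IsPreconnected (Set.range fun t : ℝ => (t, P.ξ t + n * (2 * π))) :=
      isPreconnected_range (continuous_id.prodMk (P.continuous_ξ.add continuous_const))
    refine hgraph.subset_connectedComponentIn ⟨φ, rfl⟩ ?_ ⟨x.1, Prod.ext rfl hn.symm⟩
    rintro _ ⟨t, rfl⟩
    exact P.G_ξ_add t n

end NearCosineSum

theorem half_le_cos {t : ℝ} (h : |t| ≤ π / 3) : 1 / 2 ≤ cos t := by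
  rw [← cos_pi_div_three, ← cos_abs t]
  exact cos_le_cos_of_nonneg_of_le_pi (abs_nonneg _) (by linarith [pi_pos]) h

theorem half_le_sin {t : ℝ} (h : t ∈ Set.Icc (π / 3) (2 * π / 3)) : 1 / 2 ≤ sin t := by
  rw [← cos_sub_pi_div_two]
  exact half_le_cos (abs_le.2 ⟨by linarith [h.1, pi_pos], by linarith [h.2, pi_pos]⟩)

theorem abs_le_two_mul_abs_sin {x : ℝ} (hx : |x| ≤ π / 2) : |x| ≤ 2 * |sin x| := by
  have h := mul_abs_le_abs_sin hx
  have hπ : 1 / 2 ≤ 2 / π := by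
    rw [div_le_div_iff₀ two_pos pi_pos]
    linarith [pi_le_four]
  linarith [mul_le_mul_of_nonneg_right hπ (abs_nonneg x)]

section NearNegSin

variable {N N' : ℝ → ℝ} {c ν : ℝ}

theorem abs_le_of_near_neg_sin_of_eq_zero (hc : 0 < c) {x : ℝ} (hx : |x| ≤ π / 2) (hNx : N x = 0)
    (h₀ : |N x + c * sin x| ≤ ν * c) : |x| ≤ 2 * ν := by
  rw [hNx, zero_add, abs_mul, abs_of_pos hc, mul_comm] at h₀
  linarith [abs_le_two_mul_abs_sin hx, le_of_mul_le_mul_right h₀ hc]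

theorem exists_zero_of_near_neg_sin (hN : ∀ t, HasDerivAt N (N' t) t) (hc : 0 < c)
    (hν : ν ≤ 1 / 4) (h₀ : ∀ t, |N t + c * sin t| ≤ ν * c)
    (h₁ : ∀ t, |N' t + c * cos t| ≤ 1 / 4 * c) :
    ∃ x, |x| ≤ 2 * ν ∧ |x| < π / 3 ∧ N x = 0 ∧ N' x < 0 ∧
      (∀ t ∈ Set.Ico (-(π / 3)) x, 0 < N t) ∧ ∀ t ∈ Set.Ioc x (2 * π / 3), N t < 0 := by
  have hπ := pi_pos
  have hνc : ν * c ≤ 1 / 4 * c := by gcongr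
  have hneg : ∀ t ∈ Set.Icc (π / 3) (2 * π / 3), N t < 0 := fun t ht => by
    linarith [(abs_le.1 (h₀ t)).2, mul_le_mul_of_nonneg_left (half_le_sin ht) hc.le]
  have hright : N (π / 3) < 0 := hneg _ ⟨le_rfl, by linarith⟩
  have hleft : 0 < N (-(π / 3)) := by
    have h := (abs_le.1 (h₀ (-(π / 3)))).1
    rw [sin_neg] at h
    linarith [mul_le_mul_of_nonneg_left (half_le_sin (t := π / 3) ⟨le_rfl, by linarith⟩) hc.le]
  have hderiv : ∀ t ∈ Set.Icc (-(π / 3)) (π / 3), N' t < 0 := fun t ht => by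
    linarith [(abs_le.1 (h₁ t)).2, mul_le_mul_of_nonneg_left (half_le_cos (abs_le.2 ht)) hc.le]
  have hcont : Continuous N := continuous_iff_continuousAt.2 fun t => (hN t).continuousAt
  have hanti : StrictAntiOn N (Set.Icc (-(π / 3)) (π / 3)) :=
    strictAntiOn_of_hasDerivWithinAt_neg (convex_Icc _ _) hcont.continuousOn
      (fun t _ => (hN t).hasDerivWithinAt) fun t ht => hderiv t (interior_subset ht)
  obtain ⟨x, hx, hNx⟩ := intermediate_value_Icc' (by linarith) hcont.continuousOn
    ⟨hright.le, hleft.le⟩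
  have hx_left : -(π / 3) < x := hx.1.lt_of_ne (by rintro rfl; exact hleft.ne' hNx)
  have hx_right : x < π / 3 := hx.2.lt_of_ne (by rintro rfl; exact hright.ne hNx)
  have hx_abs : |x| < π / 3 := abs_lt.2 ⟨hx_left, hx_right⟩
  refine ⟨x, abs_le_of_near_neg_sin_of_eq_zero hc (by linarith) hNx (h₀ x), hx_abs, hNx,
    hderiv x hx, fun t ht => ?_, fun t ht => ?_⟩
  · rw [← hNx]
    exact hanti ⟨ht.1, by linarith [ht.2]⟩ hx ht.2
  · rcases le_total t (π / 3) with h | h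
    · rw [← hNx]
      exact hanti hx ⟨by linarith [ht.1], h⟩ ht.1
    · exact hneg t ⟨h, ht.2⟩

theorem exists_zeros_of_near_neg_sin (hN : ∀ t, HasDerivAt N (N' t) t) (hc : 0 < c)
    (hper : Function.Periodic N (2 * π)) (hν : ν ≤ 1 / 4) (h₀ : ∀ t, |N t + c * sin t| ≤ ν * c)
    (h₁ : ∀ t, |N' t + c * cos t| ≤ 1 / 4 * c) :
    ∃ x y, x < y ∧ y < x + 2 * π ∧ |x| ≤ 2 * ν ∧ |y - π| ≤ 2 * ν ∧ N x = 0 ∧ N' x < 0 ∧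
      N y = 0 ∧ 0 < N' y ∧ (∀ t ∈ Set.Ioo x y, N t < 0) ∧
      ∀ t ∈ Set.Ioo y (x + 2 * π), 0 < N t := by
  obtain ⟨x, hx, hx_abs, hNx, hN'x, hx_pos, hx_neg⟩ := exists_zero_of_near_neg_sin hN hc hν h₀ h₁
  obtain ⟨z, hz, hz_abs, hNz, hN'z, hz_neg, hz_pos⟩ := exists_zero_of_near_neg_sin
    (N := fun t => -N (t + π)) (N' := fun t => -N' (t + π))
    (fun t => ((hN (t + π)).comp_add_const t π).neg) hc hν
    (fun t => by
      have h := h₀ (t + π)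
      rwa [sin_add_pi, mul_neg, ← abs_neg, neg_add, neg_neg] at h)
    (fun t => by
      have h := h₁ (t + π)
      rwa [cos_add_pi, mul_neg, ← abs_neg, neg_add, neg_neg] at h)
  rw [abs_lt] at hx_abs hz_abs
  refine ⟨x, z + π, by linarith, by linarith, hx, by simpa using hz, hNx, hN'x,
    neg_eq_zero.1 hNz, neg_neg_iff_pos.1 hN'z, fun t ht => ?_, fun t ht => ?_⟩
  · rcases le_total t (2 * π / 3) with h | h
    · exact hx_neg t ⟨ht.1, h⟩
    · simpa using hz_neg (t - π) ⟨by linarith, by linarith [ht.2]⟩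
  · rcases le_total t (5 * π / 3) with h | h
    · simpa using hz_pos (t - π) ⟨by linarith [ht.1], by linarith⟩
    · rw [← hper.sub_eq t]
      exact hx_pos _ ⟨by linarith, by linarith [ht.2]⟩

end NearNegSin

/-- On one period starting at `θM` the function `f` decreases strictly from a non-degenerate
maximum at `θM` to a non-degenerate minimum at `θm` and then increases strictly. -/
def IsCosineLike (f : ℝ → ℝ) (θM θm : ℝ) : Prop :=
  deriv f θM = 0 ∧ deriv (deriv f) θM < 0 ∧ deriv f θm = 0 ∧ 0 < deriv (deriv f) θm ∧
    (∀ θ ∈ Set.Ioo θM θm, deriv f θ < 0) ∧ (∀ θ ∈ Set.Ioo θm (θM + 2 * π), 0 < deriv f θ) ∧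
    StrictAntiOn f (Set.Icc θM θm) ∧ StrictMonoOn f (Set.Icc θm (θM + 2 * π))

theorem IsCosineLike.of_deriv {f : ℝ → ℝ} {θM θm : ℝ} (hf : Continuous f)
    (hM : deriv f θM = 0) (hM' : deriv (deriv f) θM < 0)
    (hm : deriv f θm = 0) (hm' : 0 < deriv (deriv f) θm)
    (hneg : ∀ θ ∈ Set.Ioo θM θm, deriv f θ < 0)
    (hpos : ∀ θ ∈ Set.Ioo θm (θM + 2 * π), 0 < deriv f θ) : IsCosineLike f θM θm :=
  ⟨hM, hM', hm, hm', hneg, hpos,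
    strictAntiOn_of_deriv_neg (convex_Icc _ _) hf.continuousOn (by rwa [interior_Icc]),
    strictMonoOn_of_deriv_pos (convex_Icc _ _) hf.continuousOn (by rwa [interior_Icc])⟩

namespace NearCosineSum

variable (P : NearCosineSum)

/-- The restriction of `L` to the crest, as a function of `θ = proj ψ`; for the Melnikov potential
this is the reduced Poincaré function. -/
def reduced (θ : ℝ) : ℝ := P.L (P.lift θ, P.ξ (P.lift θ))

/-- The derivative of `ψ ↦ L₁(ψ, ξ(ψ))`. -/
def derivL₁ (ψ : ℝ) : ℝ := P.L₁₁ (ψ, P.ξ ψ) + P.L₁₂ (ψ, P.ξ ψ) * P.ξ' ψ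

theorem hasDerivAt_L₁_ξ (ψ : ℝ) : HasDerivAt (fun ψ => P.L₁ (ψ, P.ξ ψ)) (P.derivL₁ ψ) ψ :=
  (P.hasPartials_L₁.hasDerivAt_comp (hasDerivAt_id ψ) (P.hasDerivAt_ξ ψ)).congr_deriv
    (by rw [derivL₁, mul_one, id])

-- On the crest `L₂ = -I L₁`, so `d/dψ L(ψ, ξ(ψ)) = (1 - I ξ') L₁`, and the factor `1 - I ξ'` is
-- exactly the derivative of `proj`.
theorem hasDerivAt_reduced (θ : ℝ) :
    HasDerivAt P.reduced (P.L₁ (P.lift θ, P.ξ (P.lift θ))) θ := by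
  have h := (P.hasPartials_L.hasDerivAt_comp (hasDerivAt_id (P.lift θ))
    (P.hasDerivAt_ξ (P.lift θ))).comp θ (P.hasDerivAt_lift θ)
  refine h.congr_deriv ?_
  have hcrest := P.mul_G_eq (P.lift θ, P.ξ (P.lift θ))
  rw [P.G_ξ, mul_zero] at hcrest
  rw [← div_eq_mul_inv, div_eq_iff (P.one_sub_mul_ξ'_pos _).ne', id]
  linear_combination -P.ξ' (P.lift θ) * hcrest

theorem deriv_reduced : deriv P.reduced = fun θ => P.L₁ (P.lift θ, P.ξ (P.lift θ)) :=
  funext fun θ => (P.hasDerivAt_reduced θ).deriv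

theorem hasDerivAt_deriv_reduced (θ : ℝ) : HasDerivAt (deriv P.reduced)
    (P.derivL₁ (P.lift θ) * (1 - P.I * P.ξ' (P.lift θ))⁻¹) θ := by
  rw [deriv_reduced]
  exact (P.hasDerivAt_L₁_ξ (P.lift θ)).comp θ (P.hasDerivAt_lift θ)

theorem continuous_derivL₁ : Continuous P.derivL₁ := by
  have hgraph : Continuous fun ψ => (ψ, P.ξ ψ) := continuous_id.prodMk P.continuous_ξ
  exact (P.continuous_L₁₁.comp hgraph).add ((P.continuous_L₁₂.comp hgraph).mul P.continuous_ξ')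

theorem contDiff_reduced : ContDiff ℝ 2 P.reduced := by
  rw [show (2 : WithTop ℕ∞) = 1 + 1 by norm_num, contDiff_succ_iff_deriv]
  refine ⟨fun θ => (P.hasDerivAt_reduced θ).differentiableAt, by simp, ?_⟩
  rw [contDiff_one_iff_deriv]
  refine ⟨fun θ => (P.hasDerivAt_deriv_reduced θ).differentiableAt, ?_⟩
  rw [funext fun θ => (P.hasDerivAt_deriv_reduced θ).deriv]
  exact (P.continuous_derivL₁.comp P.lift.continuous).mul
    ((continuous_const.sub (continuous_const.mul (P.continuous_ξ'.comp P.lift.continuous))).inv₀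
      fun θ => (P.one_sub_mul_ξ'_pos _).ne')

theorem reduced_periodic : Function.Periodic P.reduced (2 * π) := fun θ => by
  rw [reduced, reduced, P.lift_add_two_pi, P.ξ_periodic, P.L_add_two_pi_fst]

theorem abs_derivL₁_add_le (ψ : ℝ) : |P.derivL₁ ψ + P.A * cos ψ| ≤ 1 / 4 * P.A := by
  have hA := P.A_pos
  have hδ := P.δ_nonneg
  have hq : 0 < 1 - P.q := sub_pos.2 P.q_lt_one
  calc |P.derivL₁ ψ + P.A * cos ψ|
      = |(P.L₁₁ (ψ, P.ξ ψ) + P.A * cos ψ) + P.L₁₂ (ψ, P.ξ ψ) * P.ξ' ψ| := by rw [derivL₁]; ring_nf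
    _ ≤ P.δ * P.A + P.δ * P.A * (8 / (1 - P.q)) := by
        refine (abs_add_le _ _).trans (add_le_add (P.L₁₁_near _ _) ?_)
        rw [abs_mul]
        exact mul_le_mul (P.L₁₂_near _ _) (P.abs_ξ'_le ψ) (abs_nonneg _) (by positivity)
    _ = (P.δ + P.δ * 8 / (1 - P.q)) * P.A := by ring
    _ ≤ (1 / 100 + 8 / 100) * P.A := by
        refine mul_le_mul_of_nonneg_right (add_le_add ?_ ?_) hA.le
        · linarith [P.δ_le_linear, P.q_nonneg]
        · rw [div_le_iff₀ hq]
          linarith [P.δ_le_linear]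
    _ ≤ 1 / 4 * P.A := by linarith

theorem exists_zeros_L₁_ξ : ∃ x y, x < y ∧ y < x + 2 * π ∧ |x| ≤ 2 * P.δ ∧ |y - π| ≤ 2 * P.δ ∧
    P.L₁ (x, P.ξ x) = 0 ∧ P.derivL₁ x < 0 ∧ P.L₁ (y, P.ξ y) = 0 ∧ 0 < P.derivL₁ y ∧
    (∀ ψ ∈ Set.Ioo x y, P.L₁ (ψ, P.ξ ψ) < 0) ∧
    ∀ ψ ∈ Set.Ioo y (x + 2 * π), 0 < P.L₁ (ψ, P.ξ ψ) :=
  exists_zeros_of_near_neg_sin P.hasDerivAt_L₁_ξ P.A_pos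
    (fun ψ => by rw [P.ξ_periodic ψ, P.L₁_add_two_pi_fst])
    (by linarith [P.δ_le_linear, P.q_nonneg]) (fun ψ => P.L₁_near ψ _) P.abs_derivL₁_add_le

theorem isCosineLike_reduced {x y : ℝ} (hx : P.L₁ (x, P.ξ x) = 0) (hx' : P.derivL₁ x < 0)
    (hy : P.L₁ (y, P.ξ y) = 0) (hy' : 0 < P.derivL₁ y)
    (hneg : ∀ ψ ∈ Set.Ioo x y, P.L₁ (ψ, P.ξ ψ) < 0)
    (hpos : ∀ ψ ∈ Set.Ioo y (x + 2 * π), 0 < P.L₁ (ψ, P.ξ ψ)) :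
    IsCosineLike P.reduced (P.proj x) (P.proj y) := by
  have hderiv : ∀ ψ, deriv P.reduced (P.proj ψ) = P.L₁ (ψ, P.ξ ψ) := fun ψ => by
    rw [(P.hasDerivAt_reduced _).deriv, P.lift_proj]
  have hderiv₂ : ∀ ψ, deriv (deriv P.reduced) (P.proj ψ) =
      P.derivL₁ ψ * (1 - P.I * P.ξ' ψ)⁻¹ := fun ψ => by
    rw [(P.hasDerivAt_deriv_reduced _).deriv, P.lift_proj]
  have hinv : ∀ ψ, 0 < (1 - P.I * P.ξ' ψ)⁻¹ := fun ψ => inv_pos.2 (P.one_sub_mul_ξ'_pos ψ)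
  refine .of_deriv P.contDiff_reduced.continuous (by rw [hderiv, hx]) ?_ (by rw [hderiv, hy]) ?_
    (fun θ hθ => ?_) (fun θ hθ => ?_)
  · rw [hderiv₂]
    exact mul_neg_of_neg_of_pos hx' (hinv x)
  · rw [hderiv₂]
    exact mul_pos hy' (hinv y)
  · rw [P.deriv_reduced]
    exact hneg _ (P.lift_mem_Ioo hθ)
  · rw [P.deriv_reduced]
    rw [← P.proj_add_two_pi] at hθ
    exact hpos _ (P.lift_mem_Ioo hθ)

theorem abs_proj_sub_le {x c : ℝ} (hsin : |sin x| = |sin (x - c)|) (hx : |x - c| ≤ 2 * P.δ) :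
    |P.proj x - c| ≤ 6 * P.δ * (1 + |P.I|) := by
  have hξ : |P.ξ x| ≤ 6 * P.δ := by
    linarith [abs_le_two_mul_abs_sin (P.abs_ξ_lt x).le, P.abs_sin_ξ_le x,
      abs_sin_le_abs (x := x - c)]
  calc |P.proj x - c| = |(x - c) - P.I * P.ξ x| := by rw [NearSineSum.proj, sub_right_comm]
    _ ≤ 2 * P.δ + |P.I| * (6 * P.δ) := by
        refine (abs_sub _ _).trans (add_le_add hx ?_)
        rw [abs_mul]
        gcongr
    _ ≤ _ := by linarith [P.δ_nonneg]

theorem exists_isCosineLike_reduced : ∃ θM θm, θM < θm ∧ θm < θM + 2 * π ∧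
    |θM| ≤ 6 * P.δ * (1 + |P.I|) ∧ |θm - π| ≤ 6 * P.δ * (1 + |P.I|) ∧
    IsCosineLike P.reduced θM θm := by
  obtain ⟨x, y, hxy, hyx, hx, hy, hzero⟩ := P.exists_zeros_L₁_ξ
  obtain ⟨hLx, hLx', hLy, hLy', hneg, hpos⟩ := hzero
  refine ⟨P.proj x, P.proj y, P.strictMono_proj hxy, ?_, ?_, ?_,
    P.isCosineLike_reduced hLx hLx' hLy hLy' hneg hpos⟩
  · rw [← P.proj_add_two_pi]
    exact P.strictMono_proj hyx
  · simpa using P.abs_proj_sub_le (x := x) (c := 0) (by rw [sub_zero]) (by rwa [sub_zero])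
  · exact P.abs_proj_sub_le (by rw [sin_sub_pi, abs_neg]) hy

end NearCosineSum

theorem A_one_zero (a : ℕ → ℕ → ℝ) (I : ℝ) : A a 1 0 I = sechWeight I * a 1 0 := by
  simp [A_eq_sechWeight_mul]

theorem A_zero_one (a : ℕ → ℕ → ℝ) (I : ℝ) : A a 0 1 I = sechWeight (-1) * a 0 1 := by
  simp [A_eq_sechWeight_mul]

/-- The coefficients of `I ∂_φ 𝓛 + ∂_s 𝓛`, divided by `A_{0,1}`. -/
def crestCoeff (a : ℕ → ℕ → ℝ) (I : ℝ) (n : ℕ × ℕ) : ℝ :=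
  (n.1 * I - n.2) * A a n.1 n.2 I / A a 0 1 I

section Decay

variable {a : ℕ → ℕ → ℝ} {α ε : ℝ}

theorem sq_mul_abs_A_le (ha : GeometricDecay α 0 ε fun n => a n.1 n.2) (I : ℝ) (n : ℕ × ℕ) :
    (1 + |n.1 * I - n.2|) ^ 2 * |A a n.1 n.2 I| ≤ 216 * α * (5 * ε) ^ (n.1 + n.2) := by
  have hα := ha.const_nonneg
  have hε := ha.ratio_nonneg
  rw [A_eq_sechWeight_mul, abs_mul, abs_of_pos (sechWeight_pos _), ← mul_assoc, mul_assoc 216]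
  refine mul_le_mul (one_add_abs_sq_mul_sechWeight_le _) ((ha.abs_le n).trans ?_) (abs_nonneg _)
    (by norm_num)
  rw [pow_zero, one_mul]
  gcongr
  linarith

theorem geometricDecay_A (ha : GeometricDecay α 0 ε fun n => a n.1 n.2) (hε : ε ≤ 1 / 10) (I : ℝ) :
    GeometricDecay (216 * α) 0 (5 * ε) fun n => A a n.1 n.2 I where
  ratio_nonneg := by linarith [ha.ratio_nonneg]
  ratio_le := by linarith
  abs_le n := by
    rw [pow_zero, one_mul]
    refine le_trans ?_ (sq_mul_abs_A_le ha I n)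
    exact le_mul_of_one_le_left (abs_nonneg _)
      (one_le_pow₀ (le_add_of_nonneg_right (abs_nonneg _)))

theorem geometricDecay_fst_mul_A (ha : GeometricDecay α 0 ε fun n => a n.1 n.2) (hε : ε ≤ 1 / 10)
    (I : ℝ) :
    GeometricDecay (216 * α * sechWeight I) 1 (5 * ε) fun n => n.1 * A a n.1 n.2 I where
  ratio_nonneg := by linarith [ha.ratio_nonneg]
  ratio_le := by linarith
  abs_le := by
    rintro ⟨k, l⟩
    have hα := ha.const_nonneg
    have hε := ha.ratio_nonneg
    have hw := sechWeight_pos I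
    rcases eq_or_ne k 0 with rfl | hk
    · simp only [Nat.cast_zero, zero_mul, abs_zero]
      positivity
    · have hak : |a k l| ≤ α * ε ^ (k + l) := by simpa using ha.abs_le (k, l)
      have hkl : (k : ℝ) ≤ 1 + k + l := by linarith [(Nat.cast_nonneg l : (0 : ℝ) ≤ l)]
      have hpow : (5 : ℝ) ^ l ≤ 5 ^ (k + l) := by gcongr <;> simp
      rw [A_eq_sechWeight_mul, abs_mul, abs_mul, abs_of_pos (sechWeight_pos _), Nat.abs_cast]
      calc (k : ℝ) * (sechWeight (k * I - l) * |a k l|)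
          ≤ (1 + k + l) * ((4 * 5 ^ l * sechWeight I) * (α * ε ^ (k + l))) := by
            gcongr
            · exact mul_nonneg (sechWeight_pos _).le (abs_nonneg _)
            · exact sechWeight_mul_sub_le hk l I
        _ ≤ (1 + k + l) * ((216 * 5 ^ (k + l) * sechWeight I) * (α * ε ^ (k + l))) := by
            gcongr
            norm_num
        _ = _ := by
            rw [mul_pow]
            ring

theorem one_add_abs_mul_fst_le (I : ℝ) (n : ℕ × ℕ) :
    (1 + |I|) * n.1 ≤ (1 + n.1 + n.2) * (1 + |n.1 * I - n.2|) := by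
  have hkI : n.1 * |I| ≤ |n.1 * I - n.2| + n.2 :=
    calc n.1 * |I| = |(n.1 * I - n.2) + n.2| := by rw [sub_add_cancel, abs_mul, Nat.abs_cast]
      _ ≤ |n.1 * I - n.2| + n.2 := (abs_add_le _ _).trans_eq (by rw [Nat.abs_cast])
  nlinarith [abs_nonneg (n.1 * I - n.2)]

variable {I : ℝ}

theorem geometricDecay_crestCoeff (ha : GeometricDecay α 0 ε fun n => a n.1 n.2) (hε : ε ≤ 1 / 10)
    (hA : 0 < A a 0 1 I) :
    GeometricDecay (216 * α / A a 0 1 I) 0 (5 * ε) (crestCoeff a I) where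
  ratio_nonneg := by linarith [ha.ratio_nonneg]
  ratio_le := by linarith
  abs_le n := by
    rw [crestCoeff, pow_zero, one_mul, abs_div, abs_of_pos hA, div_mul_eq_mul_div,
      abs_mul]
    refine div_le_div_of_nonneg_right (le_trans ?_ (sq_mul_abs_A_le ha I n)) hA.le
    gcongr
    nlinarith [abs_nonneg (n.1 * I - n.2)]

theorem geometricDecay_fst_mul_crestCoeff (ha : GeometricDecay α 0 ε fun n => a n.1 n.2)
    (hε : ε ≤ 1 / 10) (hA : 0 < A a 0 1 I) :
    GeometricDecay (216 * α / A a 0 1 I / (1 + |I|)) 2 (5 * ε)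
      fun n => n.1 * crestCoeff a I n where
  ratio_nonneg := by linarith [ha.ratio_nonneg]
  ratio_le := by linarith
  abs_le n := by
    have hn : (1 : ℝ) ≤ 1 + n.1 + n.2 := by
      rw [add_assoc]
      exact le_add_of_nonneg_right (by positivity)
    rw [crestCoeff, ← mul_div_assoc, abs_div, abs_of_pos hA, div_div,
      div_mul_eq_mul_div, mul_comm (A a 0 1 I), ← div_div]
    refine div_le_div_of_nonneg_right ?_ hA.le
    rw [le_div_iff₀ (by positivity), abs_mul, abs_mul, Nat.abs_cast]
    set ω := (n.1 : ℝ) * I - n.2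
    calc n.1 * (|ω| * |A a n.1 n.2 I|) * (1 + |I|)
        = ((1 + |I|) * n.1) * (|ω| * |A a n.1 n.2 I|) := by ring
      _ ≤ ((1 + n.1 + n.2) * (1 + |ω|)) * ((1 + |ω|) * |A a n.1 n.2 I|) := by
          gcongr ?_ * (?_ * _)
          · exact one_add_abs_mul_fst_le I n
          · linarith
      _ = (1 + n.1 + n.2) * ((1 + |ω|) ^ 2 * |A a n.1 n.2 I|) := by ring
      _ ≤ (1 + n.1 + n.2) ^ 2 * (216 * α * (5 * ε) ^ (n.1 + n.2)) := by
          gcongr ?_ * ?_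
          · exact le_self_pow₀ hn two_ne_zero
          · exact sq_mul_abs_A_le ha I n
      _ = _ := by ring

end Decay

/-- The bound of the harmonics of order at least two of the Melnikov potential, when
`|a_{k,l}| ≤ α ε^(k+l)`. -/
def tailBound (α ε : ℝ) : ℝ := 216 * α * tailConst * (5 * ε) ^ 2

/-- The smallness conditions on the Fourier coefficients under which the Melnikov potential is
close to a sum of two cosines: the harmonics of order at least two are at most `δ` times each of
the first ones, and `q < 1` is an upper bound for the slope of the crest. -/
structure FourierBounds (a σ : ℕ → ℕ → ℝ) (α ε δ q : ℝ) : Prop where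
  decay : GeometricDecay α 0 ε fun n => a n.1 n.2
  ε_le : ε ≤ 1 / 10
  q_lt_one : q < 1
  δ_le : δ ≤ (1 - q) ^ 2 / 100
  one_zero_pos : 0 < a 1 0
  zero_one_pos : 0 < a 0 1
  phase_one_zero : σ 1 0 = 0
  phase_zero_one : σ 0 1 = 0
  kappa_mul_le : kappa * a 1 0 ≤ q * a 0 1
  tailBound_le_one_zero : tailBound α ε ≤ δ * a 1 0
  tailBound_le_zero_one : tailBound α ε ≤ δ * a 0 1

namespace FourierBounds

variable {a σ : ℕ → ℕ → ℝ} {α ε δ q : ℝ} (H : FourierBounds a σ α ε δ q) (I : ℝ)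

include H

theorem A_zero_one_pos : 0 < A a 0 1 I := mul_pos (sechWeight_pos _) H.zero_one_pos

theorem A_one_zero_pos : 0 < A a 1 0 I := mul_pos (sechWeight_pos _) H.one_zero_pos

theorem tailBound_nonneg : 0 ≤ tailBound α ε := by
  have := H.decay.const_nonneg
  have := tailConst_pos
  rw [tailBound]
  positivity

theorem two_mul_tailBound_le : 2 * tailBound α ε ≤ δ * A a 0 1 I :=
  calc 2 * tailBound α ε ≤ sechWeight (-1) * (δ * a 0 1) :=
        mul_le_mul two_le_sechWeight_neg_one H.tailBound_le_zero_one H.tailBound_nonneg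
          (sechWeight_pos _).le
    _ = δ * A a 0 1 I := by rw [A_zero_one, mul_left_comm]

theorem tailBound_div_le : tailBound α ε / A a 0 1 I ≤ δ := by
  rw [div_le_iff₀ (H.A_zero_one_pos I)]
  linarith [H.two_mul_tailBound_le I, H.tailBound_nonneg]

theorem tailBound_mul_sechWeight_le : tailBound α ε * sechWeight I ≤ δ * A a 1 0 I := by
  rw [A_one_zero, mul_left_comm, mul_comm]
  exact mul_le_mul_of_nonneg_left H.tailBound_le_one_zero (sechWeight_pos I).le

theorem mul_A_le_of_mul_sechWeight_le {t : ℝ}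
    (ht : t * sechWeight I ≤ kappa * sechWeight (-1)) : t * A a 1 0 I ≤ q * A a 0 1 I := by
  rw [A_zero_one, A_one_zero]
  linarith [mul_le_mul_of_nonneg_right ht H.one_zero_pos.le,
    mul_le_mul_of_nonneg_left H.kappa_mul_le (sechWeight_pos (-1)).le]

theorem abs_crestSlope_le : |crestSlope a I| ≤ q := by
  rw [crestSlope, abs_div, abs_mul, abs_of_pos (H.A_one_zero_pos I),
    abs_of_pos (H.A_zero_one_pos I), div_le_iff₀ (H.A_zero_one_pos I)]
  exact H.mul_A_le_of_mul_sechWeight_le I (abs_mul_sechWeight_le I)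

theorem abs_mul_crestSlope_le : |I * crestSlope a I| ≤ q := by
  rw [crestSlope, ← mul_div_assoc, ← mul_assoc, abs_div, abs_mul, abs_mul_self,
    abs_of_pos (H.A_one_zero_pos I), abs_of_pos (H.A_zero_one_pos I),
    div_le_iff₀ (H.A_zero_one_pos I), ← sq]
  exact H.mul_A_le_of_mul_sechWeight_le I (sq_mul_sechWeight_le I)

theorem decay_A : GeometricDecay (216 * α) 0 (5 * ε) fun n => A a n.1 n.2 I :=
  geometricDecay_A H.decay H.ε_le I

theorem decay_fst_mul_A :
    GeometricDecay (216 * α * sechWeight I) 1 (5 * ε) fun n => n.1 * A a n.1 n.2 I :=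
  geometricDecay_fst_mul_A H.decay H.ε_le I

theorem decay_crestCoeff :
    GeometricDecay (216 * α / A a 0 1 I) 0 (5 * ε) (crestCoeff a I) :=
  geometricDecay_crestCoeff H.decay H.ε_le (H.A_zero_one_pos I)

theorem decay_fst_mul_crestCoeff :
    GeometricDecay (216 * α / A a 0 1 I / (1 + |I|)) 2 (5 * ε) fun n => n.1 * crestCoeff a I n :=
  geometricDecay_fst_mul_crestCoeff H.decay H.ε_le (H.A_zero_one_pos I)

theorem abs_L_sub_le (φ s : ℝ) :
    |trigSeries (fun n => A a n.1 n.2 I) (fun n => σ n.1 n.2) (φ, s)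
      - (A a 0 0 I * cos (σ 0 0) + A a 1 0 I * cos φ + A a 0 1 I * cos s)| ≤ tailBound α ε := by
  have h := (H.decay_A I).abs_trigSeries_sub_le (σ := fun n => σ n.1 n.2) zero_le_two (φ, s)
  simpa only [H.phase_one_zero, H.phase_zero_one, sub_zero, add_zero, tailBound] using h

theorem abs_L_sub_sub_le (φ s : ℝ) :
    |trigSeries (fun n => A a n.1 n.2 I) (fun n => σ n.1 n.2) (φ, s)
      - trigSeries (fun n => A a n.1 n.2 I) (fun n => σ n.1 n.2) (φ, 0)
      - A a 0 1 I * (cos s - 1)| ≤ δ * A a 0 1 I := by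
  refine le_of_eq_of_le (congrArg _ ?_) ((abs_sub _ _).trans
    ((add_le_add (H.abs_L_sub_le I φ s) (H.abs_L_sub_le I φ 0)).trans
      ((two_mul _).symm.trans_le (H.two_mul_tailBound_le I))))
  rw [cos_zero]
  ring

theorem abs_L₁_add_le (φ s : ℝ) :
    |trigSeries (fun n => n.1 * A a n.1 n.2 I) (fun n => σ n.1 n.2 - π / 2) (φ, s)
      + A a 1 0 I * sin φ| ≤ δ * A a 1 0 I := by
  have h := (H.decay_fst_mul_A I).abs_trigSeries_sub_le (σ := fun n => σ n.1 n.2 - π / 2)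
    one_le_two (φ, s)
  refine le_trans (le_of_eq_of_le (congrArg _ ?_) h)
    (le_of_eq_of_le ?_ (H.tailBound_mul_sechWeight_le I))
  · simp [H.phase_one_zero, cos_add_pi_div_two]
  · rw [tailBound]
    ring

theorem abs_L₁₁_add_le (φ s : ℝ) :
    |trigSeries (fun n => n.1 * (n.1 * A a n.1 n.2 I)) (fun n => σ n.1 n.2 - π / 2 - π / 2) (φ, s)
      + A a 1 0 I * cos φ| ≤ δ * A a 1 0 I := by
  have h := (H.decay_fst_mul_A I).fst_mul.abs_trigSeries_sub_le
    (σ := fun n => σ n.1 n.2 - π / 2 - π / 2) le_rfl (φ, s)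
  refine le_trans (le_of_eq_of_le (congrArg _ ?_) h)
    (le_of_eq_of_le ?_ (H.tailBound_mul_sechWeight_le I))
  · simp [H.phase_one_zero, sub_eq_add_neg]
  · rw [tailBound]
    ring

theorem abs_L₁₂_le (φ s : ℝ) :
    |trigSeries (fun n => -n.2 * (n.1 * A a n.1 n.2 I)) (fun n => σ n.1 n.2 - π / 2 - π / 2) (φ, s)|
      ≤ δ * A a 1 0 I := by
  have h := (H.decay_fst_mul_A I).neg_snd_mul.abs_trigSeries_sub_le
    (σ := fun n => σ n.1 n.2 - π / 2 - π / 2) le_rfl (φ, s)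
  refine le_trans (le_of_eq_of_le (congrArg _ ?_) h)
    (le_of_eq_of_le ?_ (H.tailBound_mul_sechWeight_le I))
  · simp
  · rw [tailBound]
    ring

theorem crestCoeff_zero_one : crestCoeff a I (0, 1) = -1 := by
  rw [crestCoeff, mul_div_assoc, div_self (H.A_zero_one_pos I).ne']
  simp

omit H in
theorem crestCoeff_one_zero : crestCoeff a I (1, 0) = crestSlope a I := by
  simp [crestCoeff, crestSlope]

theorem abs_G_add_le_tailBound_div (φ s : ℝ) :
    |trigSeries (crestCoeff a I) (fun n => σ n.1 n.2 - π / 2) (φ, s)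
      + (crestSlope a I * sin φ + sin s)| ≤ tailBound α ε / A a 0 1 I := by
  have h := (H.decay_crestCoeff I).abs_trigSeries_sub_le (σ := fun n => σ n.1 n.2 - π / 2)
    zero_le_two (φ, s)
  refine le_of_eq_of_le (congrArg _ ?_) (h.trans_eq ?_)
  · rw [H.crestCoeff_zero_one, crestCoeff_one_zero]
    simp only [crestCoeff, Nat.cast_zero, zero_mul, sub_self, zero_div, zero_sub, sub_neg_eq_add,
      H.phase_one_zero, H.phase_zero_one, cos_sub_pi_div_two, cos_add_pi_div_two,
      ← sub_eq_add_neg, neg_mul, mul_neg, one_mul]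
    ring
  · rw [tailBound]
    ring

theorem abs_G_add_le (φ s : ℝ) :
    |trigSeries (crestCoeff a I) (fun n => σ n.1 n.2 - π / 2) (φ, s)
      + (crestSlope a I * sin φ + sin s)| ≤ δ :=
  (H.abs_G_add_le_tailBound_div I φ s).trans (H.tailBound_div_le I)

theorem abs_G₁_add_le (φ s : ℝ) :
    (1 + |I|) * |trigSeries (fun n => n.1 * crestCoeff a I n)
      (fun n => σ n.1 n.2 - π / 2 - π / 2) (φ, s) + crestSlope a I * cos φ| ≤ δ := by
  have h := (H.decay_fst_mul_crestCoeff I).abs_trigSeries_sub_le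
    (σ := fun n => σ n.1 n.2 - π / 2 - π / 2) le_rfl (φ, s)
  refine le_trans ?_ (H.tailBound_div_le I)
  rw [← le_div_iff₀' (by positivity)]
  refine le_of_eq_of_le (congrArg _ ?_) (h.trans_eq ?_)
  · rw [crestCoeff_one_zero]
    simp [H.phase_one_zero, sub_eq_add_neg]
  · rw [tailBound]
    ring

theorem abs_G₂_add_le (φ s : ℝ) :
    |trigSeries (fun n => -n.2 * crestCoeff a I n)
      (fun n => σ n.1 n.2 - π / 2 - π / 2) (φ, s) + cos s| ≤ δ := by
  have h := (H.decay_crestCoeff I).neg_snd_mul.abs_trigSeries_sub_le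
    (σ := fun n => σ n.1 n.2 - π / 2 - π / 2) one_le_two (φ, s)
  refine le_of_eq_of_le (congrArg _ ?_) ((h.trans_eq ?_).trans (H.tailBound_div_le I))
  · have hcos : cos (s + (-(π / 2) - π / 2)) = -cos s := by
      rw [neg_sub_left, add_halves, ← sub_eq_add_neg, cos_sub_pi]
    rw [H.crestCoeff_zero_one]
    simp [H.phase_zero_one, hcos]
  · rw [tailBound]
    ring

theorem A_zero_one_mul_G_eq (x : ℝ × ℝ) :
    A a 0 1 I * trigSeries (crestCoeff a I) (fun n => σ n.1 n.2 - π / 2) x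
      = I * trigSeries (fun n => n.1 * A a n.1 n.2 I) (fun n => σ n.1 n.2 - π / 2) x
        + trigSeries (fun n => -n.2 * A a n.1 n.2 I) (fun n => σ n.1 n.2 - π / 2) x := by
  rw [const_mul_trigSeries_add (H.decay_fst_mul_A I).summable (H.decay_A I).neg_snd_mul.summable,
    trigSeries, ← tsum_mul_left]
  refine tsum_congr fun n => ?_
  rw [crestCoeff, ← mul_assoc, mul_div_cancel₀ _ (H.A_zero_one_pos I).ne']
  ring

end FourierBounds

/-- The function `(I ∂_φ 𝓛 + ∂_s 𝓛) / A_{0,1}`, close to `-(α(I) sin φ + sin s)`. -/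
def FourierBounds.nearSineSum {a σ : ℕ → ℕ → ℝ} {α ε δ q : ℝ}
    (H : FourierBounds a σ α ε δ q) (I : ℝ) : NearSineSum where
  G := trigSeries (crestCoeff a I) fun n => σ n.1 n.2 - π / 2
  G₁ := trigSeries (fun n => n.1 * crestCoeff a I n) fun n => σ n.1 n.2 - π / 2 - π / 2
  G₂ := trigSeries (fun n => -n.2 * crestCoeff a I n) fun n => σ n.1 n.2 - π / 2 - π / 2
  I := I
  a := crestSlope a I
  q := q
  δ := δ
  q_lt_one := H.q_lt_one
  δ_le := H.δ_le
  abs_a_le := H.abs_crestSlope_le I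
  abs_mul_a_le := H.abs_mul_crestSlope_le I
  hasPartials_G := (H.decay_crestCoeff I).hasPartials_trigSeries
  continuous_G₁ := continuous_trigSeries (H.decay_crestCoeff I).fst_mul.summable
  continuous_G₂ := continuous_trigSeries (H.decay_crestCoeff I).neg_snd_mul.summable
  G_add_two_pi_fst := trigSeries_add_two_pi_fst
  G_add_two_pi_snd := trigSeries_add_two_pi_snd
  G_near := H.abs_G_add_le I
  G₁_near := H.abs_G₁_add_le I
  G₂_near := H.abs_G₂_add_le I

/-- The Fourier series of the Melnikov potential, close to a constant plus
`A_{1,0}(I) cos φ + A_{0,1} cos s`. -/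
def FourierBounds.nearCosineSum {a σ : ℕ → ℕ → ℝ} {α ε δ q : ℝ}
    (H : FourierBounds a σ α ε δ q) (I : ℝ) : NearCosineSum where
  toNearSineSum := H.nearSineSum I
  L := trigSeries (fun n => APrioriUnstable.A a n.1 n.2 I) fun n => σ n.1 n.2
  L₁ := trigSeries (fun n => n.1 * APrioriUnstable.A a n.1 n.2 I) fun n => σ n.1 n.2 - π / 2
  L₂ := trigSeries (fun n => -n.2 * APrioriUnstable.A a n.1 n.2 I) fun n => σ n.1 n.2 - π / 2
  L₁₁ := trigSeries (fun n => n.1 * (n.1 * APrioriUnstable.A a n.1 n.2 I))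
    fun n => σ n.1 n.2 - π / 2 - π / 2
  L₁₂ := trigSeries (fun n => -n.2 * (n.1 * APrioriUnstable.A a n.1 n.2 I))
    fun n => σ n.1 n.2 - π / 2 - π / 2
  A := APrioriUnstable.A a 1 0 I
  B := APrioriUnstable.A a 0 1 I
  A_pos := H.A_one_zero_pos I
  B_pos := H.A_zero_one_pos I
  hasPartials_L := (H.decay_A I).hasPartials_trigSeries
  hasPartials_L₁ := (H.decay_fst_mul_A I).hasPartials_trigSeries
  continuous_L₁₁ := continuous_trigSeries (H.decay_fst_mul_A I).fst_mul.summable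
  continuous_L₁₂ := continuous_trigSeries (H.decay_fst_mul_A I).neg_snd_mul.summable
  mul_G_eq := H.A_zero_one_mul_G_eq I
  L_add_two_pi_fst := trigSeries_add_two_pi_fst
  L_add_two_pi_snd := trigSeries_add_two_pi_snd
  L₁_add_two_pi_fst := trigSeries_add_two_pi_fst
  L_near := H.abs_L_sub_sub_le I
  L₁_near := H.abs_L₁_add_le I
  L₁₁_near := H.abs_L₁₁_add_le I
  L₁₂_near := H.abs_L₁₂_le I

namespace FourierBounds

variable {a σ : ℕ → ℕ → ℝ} {α ε δ q e : ℝ} (H : FourierBounds a σ α ε δ q)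
  (he : e = 1 ∨ e = -1) (I : ℝ)

include H he

theorem melnikov_eq (φ s : ℝ) : melnikov a σ e I φ s = (H.nearCosineSum I).L (φ, s) :=
  melnikov_eq_trigSeries he H.decay.summable I φ s

theorem crest_eq : crest a σ e I = {x | (H.nearCosineSum I).G x = 0} := by
  ext ⟨φ, s⟩
  simp only [crest, Set.mem_ofPred_eq, H.melnikov_eq he]
  rw [((H.nearCosineSum I).hasPartials_L.hasDerivAt_fst φ s).deriv,
    ((H.nearCosineSum I).hasPartials_L.hasDerivAt_snd φ s).deriv]
  exact (Eq.congr_left ((H.nearCosineSum I).mul_G_eq (φ, s)).symm).trans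
    (mul_eq_zero_iff_left (H.nearCosineSum I).B_pos.ne')

theorem crestM_eq : crestM a σ e I = (H.nearCosineSum I).liftedGraph := by
  ext x
  rw [← (H.nearCosineSum I).mem_component_of_isMax_iff]
  simp only [crestM, H.crest_eq he, H.melnikov_eq he, Set.mem_ofPred_eq]

theorem mem_crestM_iff_ξ (φ s : ℝ) :
    (φ, s) ∈ crestM a σ e I ↔ ∃ n : ℤ, s = (H.nearCosineSum I).ξ φ + n * (2 * π) := by
  rw [H.crestM_eq he]
  rfl

theorem xiM_eq (φ : ℝ) : xiM a σ e I φ = (H.nearCosineSum I).ξ φ := by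
  have hξ := abs_lt.1 ((H.nearCosineSum I).abs_ξ_lt φ)
  have hξ_mem : (H.nearCosineSum I).ξ φ ∈ Set.Ioc (-π) π :=
    ⟨by linarith [pi_pos], by linarith [pi_pos]⟩
  have hxi : xiM a σ e I φ ∈ Set.Ioc (-π) π ∧ (φ, xiM a σ e I φ) ∈ crestM a σ e I :=
    Classical.epsilon_spec (p := fun s => s ∈ Set.Ioc (-π) π ∧ (φ, s) ∈ crestM a σ e I)
      ⟨_, hξ_mem, (H.mem_crestM_iff_ξ he I φ _).2 ⟨0, by simp⟩⟩
  obtain ⟨n, hn⟩ := (H.mem_crestM_iff_ξ he I φ _).1 hxi.2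
  have h_self {x : ℝ} (hx : x ∈ Set.Ioc (-π) π) : toIocMod two_pi_pos (-π) x = x :=
    (toIocMod_eq_self two_pi_pos).2 (by rwa [show -π + 2 * π = π by ring])
  rw [← h_self hxi.1, hn, ← zsmul_eq_mul, toIocMod_add_zsmul, h_self hξ_mem]

theorem mem_crestM_iff (φ s : ℝ) :
    (φ, s) ∈ crestM a σ e I ↔ ∃ n : ℤ, s = xiM a σ e I φ + 2 * π * n := by
  simp only [H.mem_crestM_iff_ξ he, H.xiM_eq he, mul_comm]

theorem isTauStar_iff {φ s τ : ℝ} (hs : |s| ≤ π / 2) :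
    IsTauStar a σ e I φ s τ ↔ τ = (H.nearCosineSum I).crossing φ s := by
  rw [← (H.nearCosineSum I).isLeast_iff_eq_crossing hs, IsTauStar, H.crestM_eq he]
  rfl

theorem existsUnique_isTauStar (φ : ℝ) {s : ℝ} (hs : |s| ≤ π / 2) :
    ∃! τ, IsTauStar a σ e I φ s τ :=
  ⟨_, (H.isTauStar_iff he I hs).2 rfl, fun _ => (H.isTauStar_iff he I hs).1⟩

theorem tauStar_eq (φ : ℝ) {s : ℝ} (hs : |s| ≤ π / 2) :
    tauStar a σ e I φ s = (H.nearCosineSum I).crossing φ s :=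
  (H.isTauStar_iff he I hs).1 (Classical.epsilon_spec (H.existsUnique_isTauStar he I φ hs).exists)

theorem sub_mul_tauStar (φ : ℝ) {s : ℝ} (hs : |s| ≤ π / 2) :
    φ - I * tauStar a σ e I φ s = (H.nearCosineSum I).lift (φ - I * s) := by
  rw [H.tauStar_eq he I φ hs]
  exact (H.nearCosineSum I).sub_mul_crossing φ s

theorem melnikov_tauStar (φ : ℝ) {s : ℝ} (hs : |s| ≤ π / 2) :
    melnikov a σ e I (φ - I * tauStar a σ e I φ s) (s - tauStar a σ e I φ s)
      = (H.nearCosineSum I).reduced (φ - I * s) := by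
  have h_sub : s - tauStar a σ e I φ s
      = (H.nearCosineSum I).ξ ((H.nearCosineSum I).lift (φ - I * s)) := by
    rw [H.tauStar_eq he I φ hs]
    exact (H.nearCosineSum I).sub_crossing φ s
  rw [h_sub, H.sub_mul_tauStar he I φ hs, H.melnikov_eq he, NearCosineSum.reduced]

theorem reducedPoincare_eq : reducedPoincare a σ e I = (H.nearCosineSum I).reduced := by
  funext θ
  rw [reducedPoincare, H.melnikov_tauStar he I θ (abs_zero.trans_le pi_div_two_pos.le), mul_zero,
    sub_zero]

theorem reducedPoincare_sub_mul (φ : ℝ) {s : ℝ} (hs : |s| ≤ π / 2) :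
    reducedPoincare a σ e I (φ - I * s)
      = melnikov a σ e I (φ - I * tauStar a σ e I φ s) (s - tauStar a σ e I φ s) := by
  rw [H.melnikov_tauStar he I φ hs, H.reducedPoincare_eq he]

theorem contDiff_reducedPoincare : ContDiff ℝ 2 (reducedPoincare a σ e I) := by
  rw [H.reducedPoincare_eq he]
  exact (H.nearCosineSum I).contDiff_reduced

theorem reducedPoincare_periodic : Function.Periodic (reducedPoincare a σ e I) (2 * π) := by
  rw [H.reducedPoincare_eq he]
  exact (H.nearCosineSum I).reduced_periodic

theorem exists_isCosineLike_reducedPoincare : ∃ θM θm, θM < θm ∧ θm < θM + 2 * π ∧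
    |θM| ≤ 6 * δ * (1 + |I|) ∧ |θm - π| ≤ 6 * δ * (1 + |I|) ∧
    IsCosineLike (reducedPoincare a σ e I) θM θm := by
  rw [H.reducedPoincare_eq he]
  exact (H.nearCosineSum I).exists_isCosineLike_reduced

theorem abs_xiM_sub_le (φ : ℝ) :
    A a 0 1 I * |xiM a σ e I φ - -arcsin (crestSlope a I * sin φ)|
      ≤ 2 / (1 - q) * tailBound α ε := by
  have hq : 0 ≤ 2 / (1 - q) := div_nonneg zero_le_two (sub_nonneg.2 H.q_lt_one.le)
  have h_sin : |sin ((H.nearCosineSum I).ξ φ) + crestSlope a I * sin φ|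
      ≤ tailBound α ε / A a 0 1 I := by
    have h := H.abs_G_add_le_tailBound_div I φ ((H.nearCosineSum I).ξ φ)
    rwa [show trigSeries (crestCoeff a I) _ _ = 0 from (H.nearCosineSum I).G_ξ φ, zero_add,
      add_comm] at h
  rw [← le_div_iff₀' (H.A_zero_one_pos I), mul_div_assoc, H.xiM_eq he, sub_neg_eq_add]
  exact ((H.nearCosineSum I).abs_ξ_add_arcsin_le φ).trans (mul_le_mul_of_nonneg_left h_sin hq)

theorem abs_reducedPoincare_sub_le (θ : ℝ) :
    |reducedPoincare a σ e I θ - (A a 0 0 I * cos (σ 0 0)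
      + A a 1 0 I * cos (θ - I * tauStar a σ e I θ 0)
      + A a 0 1 I * cos (xiM a σ e I (θ - I * tauStar a σ e I θ 0)))| ≤ tailBound α ε := by
  rw [H.sub_mul_tauStar he I θ (abs_zero.trans_le pi_div_two_pos.le), mul_zero, sub_zero,
    H.xiM_eq he, H.reducedPoincare_eq he]
  exact H.abs_L_sub_le I _ _

end FourierBounds

theorem exists_mul_rpow_add_lt {γ D b : ℝ} (hγ : 0 < γ) (hD : 0 < D) (hb : 0 < b) :
    ∃ t : ℝ, 0 < t ∧ ∀ ρ r : ℝ, 0 < ρ → ρ ≤ t → 0 < r → r ≤ t → D * (ρ + r) ^ γ < b := by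
  refine ⟨(b / (2 * D)) ^ γ⁻¹ / 2, by positivity, fun ρ r hρ hρt hr hrt => ?_⟩
  have h_rpow : (ρ + r) ^ γ ≤ b / (2 * D) :=
    calc (ρ + r) ^ γ ≤ ((b / (2 * D)) ^ γ⁻¹) ^ γ :=
          rpow_le_rpow (by positivity) (by linarith) hγ.le
      _ = b / (2 * D) := rpow_inv_rpow (by positivity) hγ.ne'
  calc D * (ρ + r) ^ γ ≤ D * (b / (2 * D)) := by gcongr
    _ = b / 2 := by field_simp
    _ < b := half_lt_self hb

theorem six_mul_mul_one_add_abs_lt {x η R I : ℝ} (hx : 0 ≤ x) (hI : |I| ≤ R)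
    (h : x < η / (6 * (1 + |R|))) : 6 * x * (1 + |I|) < η :=
  calc 6 * x * (1 + |I|) ≤ 6 * x * (1 + |R|) := by
        gcongr 6 * x * (1 + ?_)
        exact hI.trans (le_abs_self R)
    _ = x * (6 * (1 + |R|)) := by ring
    _ < η := (lt_div_iff₀ (by positivity)).1 h

theorem half_add_rpow_le {ρ r β x : ℝ} (hρ : 0 < ρ) (hr : 0 < r) (hρx : ρ ^ β ≤ x)
    (hrx : r ^ β ≤ x) : ((ρ + r) / 2) ^ β ≤ x := by
  wlog h : ρ ≤ r generalizing ρ r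
  · rw [add_comm]
    exact this hr hρ hrx hρx (le_of_not_ge h)
  rcases le_total 0 β with hβ | hβ
  · exact (rpow_le_rpow (by positivity) (by linarith) hβ).trans hrx
  · exact (rpow_le_rpow_of_nonpos hρ (by linarith) hβ).trans hρx

/-- The factor `C` such that `C (ρ + r)^(2 - β)` is the ratio of the bound of the harmonics of
order at least two to the first Fourier coefficients, when these are at least
`min (α' ρ^β) (α' r^β)` and have ratio `lam`. -/
def tailRatioConst (lam α α' β : ℝ) : ℝ :=
  216 * α * tailConst * 25 * 2 ^ β / (min lam (min 1 (1 / lam)) * α')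

theorem tailRatioConst_pos {lam α α' β : ℝ} (hlam : 0 < lam) (hα : 0 < α) (hα' : 0 < α') :
    0 < tailRatioConst lam α α' β := by
  have := tailConst_pos
  rw [tailRatioConst]
  positivity

-- With `ε = ρ + r`, the lower bounds give `x ≳ ε ^ β`, and `ε ^ 2 = ε ^ (2 - β) * ε ^ β`.
theorem tailBound_le_of_lower_bounds {lam α α' β ρ r x : ℝ} (hlam : 0 < lam) (hα : 0 < α)
    (hα' : 0 < α') (hρ : 0 < ρ) (hr : 0 < r)
    (hρx : min lam (min 1 (1 / lam)) * (α' * ρ ^ β) ≤ x)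
    (hrx : min lam (min 1 (1 / lam)) * (α' * r ^ β) ≤ x) :
    tailBound α (ρ + r) ≤ tailRatioConst lam α α' β * (ρ + r) ^ (2 - β) * x := by
  rw [tailRatioConst]
  set c := min lam (min 1 (1 / lam))
  have hT := tailConst_pos
  have h_half : ((ρ + r) / 2) ^ β ≤ x / (c * α') := by
    apply half_add_rpow_le hρ hr <;> rwa [le_div_iff₀' (by positivity), mul_assoc]
  have h_split : (ρ + r) ^ 2 = (ρ + r) ^ (2 - β) * (2 ^ β * ((ρ + r) / 2) ^ β) := by
    rw [← mul_rpow zero_le_two (by positivity), mul_div_cancel₀ _ two_ne_zero,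
      ← rpow_add (by positivity), sub_add_cancel, rpow_two]
  calc tailBound α (ρ + r)
      = 216 * α * tailConst * 25 * ((ρ + r) ^ (2 - β) * (2 ^ β * ((ρ + r) / 2) ^ β)) := by
        rw [tailBound, mul_pow, h_split]
        ring
    _ ≤ 216 * α * tailConst * 25 * ((ρ + r) ^ (2 - β) * (2 ^ β * (x / (c * α')))) := by gcongr
    _ = _ := by ring

theorem geometricDecay_of_abs_le_mul_pow_mul_pow {a : ℕ → ℕ → ℝ} {α ρ r : ℝ} (hα : 0 ≤ α)
    (hρ : 0 ≤ ρ) (hr : 0 ≤ r) (hρr : ρ + r ≤ 1 / 2)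
    (h_upper : ∀ k l : ℕ, |a k l| ≤ α * ρ ^ k * r ^ l) :
    GeometricDecay α 0 (ρ + r) fun n => a n.1 n.2 where
  ratio_nonneg := add_nonneg hρ hr
  ratio_le := hρr
  abs_le n := (h_upper n.1 n.2).trans <| by
    rw [pow_zero, one_mul, mul_assoc, pow_add]
    gcongr
    exacts [le_add_of_nonneg_right hr, le_add_of_nonneg_left hρ]

theorem FourierBounds.of_pow_bounds {a σ : ℕ → ℕ → ℝ} {lam α α' β ρ r : ℝ} (hlam : 0 < lam)
    (hkappa : kappa * lam < 1) (hα : 0 < α) (hα' : 0 < α') (hρ : 0 < ρ) (hr : 0 < r)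
    (hρr : ρ + r ≤ 1 / 10)
    (hδ : tailRatioConst lam α α' β * (ρ + r) ^ (2 - β) ≤ (1 - kappa * lam) ^ 2 / 100)
    (h_upper : ∀ k l : ℕ, |a k l| ≤ α * ρ ^ k * r ^ l)
    (h_one_zero : α' * ρ ^ β ≤ a 1 0) (h_zero_one : α' * r ^ β ≤ a 0 1)
    (h_phase_one_zero : σ 1 0 = 0) (h_phase_zero_one : σ 0 1 = 0)
    (h_ratio : a 1 0 / a 0 1 = lam) :
    FourierBounds a σ α (ρ + r) (tailRatioConst lam α α' β * (ρ + r) ^ (2 - β)) (kappa * lam) := by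
  have h_one_zero_nonneg : 0 ≤ α' * ρ ^ β := by positivity
  have h_zero_one_nonneg : 0 ≤ α' * r ^ β := by positivity
  have h_zero_one_pos : 0 < a 0 1 := lt_of_lt_of_le (by positivity) h_zero_one
  have h_eq : a 1 0 = lam * a 0 1 := (div_eq_iff h_zero_one_pos.ne').1 h_ratio
  have h_eq' : a 0 1 = 1 / lam * a 1 0 := by rw [h_eq]; field_simp
  have hc_one : min lam (min 1 (1 / lam)) ≤ 1 := (min_le_right _ _).trans (min_le_left _ _)
  have hc_inv : min lam (min 1 (1 / lam)) ≤ 1 / lam := (min_le_right _ _).trans (min_le_right _ _)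
  exact {
    decay := geometricDecay_of_abs_le_mul_pow_mul_pow hα.le hρ.le hr.le (by linarith) h_upper
    ε_le := hρr
    q_lt_one := hkappa
    δ_le := hδ
    one_zero_pos := lt_of_lt_of_le (by positivity) h_one_zero
    zero_one_pos := h_zero_one_pos
    phase_one_zero := h_phase_one_zero
    phase_zero_one := h_phase_zero_one
    kappa_mul_le := by rw [h_eq, mul_assoc]
    tailBound_le_one_zero := tailBound_le_of_lower_bounds hlam hα hα' hρ hr
      ((mul_le_of_le_one_left h_one_zero_nonneg hc_one).trans h_one_zero)
      (h_eq ▸ mul_le_mul (min_le_left _ _) h_zero_one h_zero_one_nonneg hlam.le)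
    tailBound_le_zero_one := tailBound_le_of_lower_bounds hlam hα hα' hρ hr
      (h_eq' ▸ mul_le_mul hc_inv h_one_zero h_one_zero_nonneg (by positivity))
      ((mul_le_of_le_one_left h_zero_one_nonneg hc_one).trans h_zero_one) }

end APrioriUnstable

end

open APrioriUnstable Real in
theorem proposition1_general (lam α α' β : ℝ) (hlam : 0 < lam) (hkappa : lam < 1 / kappa)
    (hα : 0 < α) (hα' : 0 < α') (hβ : β < 2) :
    ∃ ρs rs K : ℝ, 0 < ρs ∧ 0 < rs ∧ 0 < K ∧ ∀ R η : ℝ, 0 < η →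
      ∃ ρη rη : ℝ, 0 < ρη ∧ 0 < rη ∧
      ∀ ρ r : ℝ, 0 < ρ → ρ ≤ ρs → 0 < r → r ≤ rs →
      ∀ (a σ : ℕ → ℕ → ℝ) (e : ℝ), (e = 1 ∨ e = -1) →
      (∀ k l : ℕ, |a k l| ≤ α * ρ ^ k * r ^ l) →
      α' * ρ ^ β ≤ a 1 0 → α' * r ^ β ≤ a 0 1 → σ 1 0 = 0 → σ 0 1 = 0 →
      a 1 0 / a 0 1 = lam → ∀ I : ℝ,
        (∀ φ s : ℝ, (φ, s) ∈ crestM a σ e I ↔ ∃ n : ℤ, s = xiM a σ e I φ + 2 * π * n) ∧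
        (∀ φ : ℝ, A a 0 1 I * |xiM a σ e I φ - -arcsin (crestSlope a I * sin φ)|
          ≤ K * (ρ + r) ^ 2) ∧
        (∀ φ s : ℝ, |s| ≤ π / 2 → (∃! τ : ℝ, IsTauStar a σ e I φ s τ) ∧
          reducedPoincare a σ e I (φ - I * s) =
            melnikov a σ e I (φ - I * tauStar a σ e I φ s) (s - tauStar a σ e I φ s)) ∧
        ContDiff ℝ 2 (reducedPoincare a σ e I) ∧
        Function.Periodic (reducedPoincare a σ e I) (2 * π) ∧
        (∃ θM θm : ℝ, θM < θm ∧ θm < θM + 2 * π ∧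
          (|I| ≤ R → ρ ≤ ρη → r ≤ rη → |θM| < η ∧ |θm - π| < η) ∧
          IsCosineLike (reducedPoincare a σ e I) θM θm) ∧
        (∀ θ : ℝ, |reducedPoincare a σ e I θ - (A a 0 0 I * cos (σ 0 0)
            + A a 1 0 I * cos (θ - I * tauStar a σ e I θ 0)
            + A a 0 1 I * cos (xiM a σ e I (θ - I * tauStar a σ e I θ 0)))|
          ≤ K * (ρ + r) ^ 2) := by
  have hκ : kappa * lam < 1 := (lt_div_iff₀' (zero_lt_one.trans_le kappa_bounds.1)).1 hkappa
  have hκ_nonneg : 0 ≤ kappa * lam := mul_nonneg (zero_le_one.trans kappa_bounds.1) hlam.le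
  have hq : 0 < 1 - kappa * lam := sub_pos.2 hκ
  have hT := tailConst_pos
  have hC := tailRatioConst_pos (β := β) hlam hα hα'
  obtain ⟨t, ht, h_small⟩ := exists_mul_rpow_add_lt (sub_pos.2 hβ) hC
    (b := (1 - kappa * lam) ^ 2 / 100) (by positivity)
  refine ⟨min t (1 / 20), min t (1 / 20), 2 / (1 - kappa * lam) * (216 * α * tailConst * 5 ^ 2),
    by positivity, by positivity, by positivity, fun R η hη => ?_⟩
  obtain ⟨u, hu, h_close⟩ := exists_mul_rpow_add_lt (sub_pos.2 hβ) hC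
    (b := η / (6 * (1 + |R|))) (by positivity)
  refine ⟨u, u, hu, hu, fun ρ r hρ hρs hr hrs a σ e he h_upper h10 h01 hσ10 hσ01 h_ratio I => ?_⟩
  obtain ⟨hρt, hρ20⟩ := le_min_iff.1 hρs
  obtain ⟨hrt, hr20⟩ := le_min_iff.1 hrs
  have H := FourierBounds.of_pow_bounds hlam hκ hα hα' hρ hr (by linarith)
    (h_small ρ r hρ hρt hr hrt).le h_upper h10 h01 hσ10 hσ01 h_ratio
  have hK : 2 / (1 - kappa * lam) * (216 * α * tailConst * 5 ^ 2) * (ρ + r) ^ 2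
      = 2 / (1 - kappa * lam) * tailBound α (ρ + r) := by rw [tailBound]; ring
  have hK_one : 1 ≤ 2 / (1 - kappa * lam) := (one_le_div hq).2 (by linarith)
  obtain ⟨θM, θm, h_lt, h_lt', hθM, hθm, h_cos⟩ := H.exists_isCosineLike_reducedPoincare he I
  refine hK ▸ ⟨H.mem_crestM_iff he I, H.abs_xiM_sub_le he I,
    fun φ s hs => ⟨H.existsUnique_isTauStar he I φ hs, H.reducedPoincare_sub_mul he I φ hs⟩,
    H.contDiff_reducedPoincare he I, H.reducedPoincare_periodic he I,
    ⟨θM, θm, h_lt, h_lt', fun hI hρu hru => ?_, h_cos⟩, fun θ =>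
      (H.abs_reducedPoincare_sub_le he I θ).trans (le_mul_of_one_le_left H.tailBound_nonneg hK_one)⟩
  have h_lt_η := six_mul_mul_one_add_abs_lt (by positivity) hI (h_close ρ r hρ hρu hr hru)
  exact ⟨hθM.trans_lt h_lt_η, hθm.trans_lt h_lt_η⟩

open APrioriUnstable in
theorem proposition1
    (lam α α' β : ℝ) (hlam : 0 < lam) (hkappa : lam < 1 / kappa)
    (hα' : 0 < α') (hα : α' < α) (hβ1 : 1 ≤ β) (hβ2 : β < 2) :
    ∃ ρs rs K : ℝ, 0 < ρs ∧ 0 < rs ∧ 0 < K ∧ ∀ Iplus η : ℝ, 0 < Iplus → 0 < η →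
      ∃ ρη rη : ℝ, 0 < ρη ∧ 0 < rη ∧
      ∀ ρ r : ℝ, 0 < ρ → ρ < 1 → ρ ≤ ρs → 0 < r → r < 1 → r ≤ rs →
      ∀ (a σ : ℕ → ℕ → ℝ) (e : ℝ), (e = 1 ∨ e = -1) →
      (∀ k l : ℕ, α' * ρ ^ (β * (k : ℝ)) * r ^ (β * (l : ℝ)) ≤ |a k l| ∧
        |a k l| ≤ α * ρ ^ k * r ^ l) →
      0 < a 1 0 → 0 < a 0 1 → σ 1 0 = 0 → σ 0 1 = 0 → |a 1 0 / a 0 1| = lam →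
      ∀ I ∈ Set.Icc (-(1 / 2 : ℝ)) Iplus,
        -- the crest `C_M(I)` is the curve `s = ξ_M(I,φ)` on the torus
        (∀ φ s : ℝ, (φ, s) ∈ crestM a σ e I ↔ ∃ n : ℤ, s = xiM a σ e I φ + 2 * Real.pi * n) ∧
        (∀ φ : ℝ, A a 0 1 I * |xiM a σ e I φ - -Real.arcsin (crestSlope a I * Real.sin φ)|
          ≤ K * (ρ + r) ^ 2) ∧
        -- `τ*` is well defined, and `𝓛*` is a function of `θ = φ - I s`
        (∀ φ s : ℝ, |s| ≤ Real.pi / 2 → (∃! τ : ℝ, IsTauStar a σ e I φ s τ) ∧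
          reducedPoincare a σ e I (φ - I * s) =
            melnikov a σ e I (φ - I * tauStar a σ e I φ s) (s - tauStar a σ e I φ s)) ∧
        -- `𝓛*(I,·)` is cosine-like
        ContDiff ℝ 2 (reducedPoincare a σ e I) ∧
        Function.Periodic (reducedPoincare a σ e I) (2 * Real.pi) ∧
        (∃ θM θm : ℝ, θM < θm ∧ θm < θM + 2 * Real.pi ∧
          (ρ ≤ ρη → r ≤ rη → |θM| < η ∧ |θm - Real.pi| < η) ∧
          deriv (reducedPoincare a σ e I) θM = 0 ∧
          deriv (deriv (reducedPoincare a σ e I)) θM < 0 ∧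
          deriv (reducedPoincare a σ e I) θm = 0 ∧
          0 < deriv (deriv (reducedPoincare a σ e I)) θm ∧
          (∀ θ ∈ Set.Ioo θM θm, deriv (reducedPoincare a σ e I) θ < 0) ∧
          (∀ θ ∈ Set.Ioo θm (θM + 2 * Real.pi), 0 < deriv (reducedPoincare a σ e I) θ) ∧
          StrictAntiOn (reducedPoincare a σ e I) (Set.Icc θM θm) ∧
          StrictMonoOn (reducedPoincare a σ e I) (Set.Icc θm (θM + 2 * Real.pi))) ∧
        -- the first order expression of `𝓛*`
        (∀ θ : ℝ, |reducedPoincare a σ e I θ -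
            (A a 0 0 I * Real.cos (σ 0 0)
              + A a 1 0 I * Real.cos (θ - I * tauStar a σ e I θ 0)
              + A a 0 1 I * Real.cos (xiM a σ e I (θ - I * tauStar a σ e I θ 0)))|
          ≤ K * (ρ + r) ^ 2) := by
  obtain ⟨ρs, rs, K, hρs, hrs, hK, h⟩ :=
    proposition1_general lam α α' β hlam hkappa (hα'.trans hα) hα' hβ2
  refine ⟨ρs, rs, K, hρs, hrs, hK, fun Iplus η hI hη => ?_⟩
  obtain ⟨ρη, rη, hρη, hrη, h⟩ := h (1 + Iplus) η hη
  refine ⟨ρη, rη, hρη, hrη, fun ρ r hρ _ hρs hr _ hrs a σ e he hab h10 h01 hσ10 hσ01 hl I hIm => ?_⟩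
  obtain ⟨h_crest, h_arcsin, h_tau, h_diff, h_per, ⟨θM, θm, h_lt, h_lt', h_near, h_cos⟩, h_first⟩ :=
    h ρ r hρ hρs hr hrs a σ e he (fun k l => (hab k l).2)
      (by simpa [abs_of_pos h10] using (hab 1 0).1) (by simpa [abs_of_pos h01] using (hab 0 1).1)
      hσ10 hσ01 (by rwa [abs_of_pos (div_pos h10 h01)] at hl) I
  have hIR : |I| ≤ 1 + Iplus := abs_le.2 ⟨by linarith [hIm.1], by linarith [hIm.2]⟩
  exact ⟨h_crest, h_arcsin, h_tau, h_diff, h_per, ⟨θM, θm, h_lt, h_lt', h_near hIR, h_cos⟩, h_first⟩
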